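/- Let $\Bbbk$ be a field and $Q=(I,E,h,t)$ a finite quiver ($h(\alpha)$ is the head and $t(\alpha)$ the tail of an arrow $\alpha$). In the path algebra $\Bbbk Q$ a path $\alpha_1\alpha_2\cdots\alpha_n$ traverses $\alpha_n$ first, so that $\alpha=e_{h(\alpha)}\,\alpha\,e_{t(\alpha)}$. Let $J\subseteq\Bbbk Q$ be any two-sided ideal, $\mathscr A=\Bbbk Q/J$, and $\mathscr A^r=J^r/J^{r+1}$ for $r\ge 0$ (with $J^0=\Bbbk Q$), an $\mathscr A$-bimodule. For a left $\mathscr A$-module $X$ put $X_i=e_iX$. For left $\mathscr A$-modules $V,W$ let $\mathcal C^\bullet(V,W)$ be the complex of $\Bbbk$-vector spaces with $$\mathcal C^{2r}(V,W)=\bigoplus_{i\in I}\operatorname{Hom}_\Bbbk\big((\mathscr A^r\otimes_{\mathscr A}V)_i,W_i\big),\qquad \mathcal C^{2r+1}(V,W)=\bigoplus_{\alpha\in E}\operatorname{Hom}_\Bbbk\big((\mathscr A^r\otimes_{\mathscr A}V)_{t(\alpha)},W_{h(\alpha)}\big)$$ and the following differentials. The differential $\mathcal C^{2r}\to\mathcal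 C^{2r+1}$ is $(f_i)_i\mapsto\big(f_{h(\alpha)}\circ\alpha-\alpha\circ f_{t(\alpha)}\big)_\alpha$, where $\alpha$ stands for the action of $\alpha$. The differential $\mathcal C^{2r+1}\to\mathcal C^{2r+2}$ maps $g=(g_\alpha)_\alpha$ to the components $(\mathscr A^{r+1}\otimes_{\mathscr A}V)_i\to W_i$ of the unique $\mathscr A$-linear map $\delta_g:\mathscr A^{r+1}\otimes_{\mathscr A}V\to W$ such that $$\delta_g([sx]\otimes v)=D_g(s)([x]\otimes v)\qquad(s\in J,\ x\in J^r,\ v\in V),$$ where $D_g:\Bbbk Q\to\operatorname{Hom}_\Bbbk(\mathscr A^r\otimes_{\mathscr A}V,W)$ is the $\Bbbk$-linear map with $D_g(e_i)=0$ and $D_g(\alpha_1\cdots\alpha_n)=\sum_{m=1}^n\alpha_1\cdots\alpha_{m-1}\circ g_{\alpha_m}\circ\alpha_{m+1}\cdots\alpha_n$ (each $g_\alpha$ is extended by zero to $\mathscr A^r\otimes_{\mathscr A}V=\bigoplus_i(\mathscr A^r\otimes_{\mathscr A}V)_i$). Then: (K1) $\mathscr A^p=J^p/J^{p+1}$ is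 a free $\Bbbk$-module for all $p\ge 0$; (K2) $J$ is flat as a right $\Bbbk Q$-module; and for all left $\mathscr A$-modules $V,W$ and all $p\ge 0$ there is an isomorphism of $\Bbbk$-vector spaces $$\operatorname{Ext}^p_{\mathscr A}(V,W)\simeq H^p\big(\mathcal C^\bullet(V,W)\big).$$ -/

import Mathlib

open scoped TensorProduct

universe u w t v

set_option linter.unusedSectionVars false

noncomputable section

namespace QuiverExt

/-! ## Path algebras -/

section PathAlgebra

variable (k : Type u) [Field k] (I : Type w) [Quiver.{t + 1} I]

/-- All paths of a quiver with vertex set `I` (a path is recorded with its tail and its head). -/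
abbrev AllPaths := Σ i j : I, Quiver.Path i j

/-- The path algebra `kQ`: the `k`-vector space with basis the paths of `Q`. -/
def PathAlgebra := AllPaths I →₀ k

instance : AddCommGroup (PathAlgebra k I) := inferInstanceAs (AddCommGroup (AllPaths I →₀ k))

instance : Module k (PathAlgebra k I) := inferInstanceAs (Module k (AllPaths I →₀ k))

variable {I}

/-- A path, as an element of the path algebra. -/
def ofPath {i j : I} (p : Quiver.Path i j) : PathAlgebra k I :=
  Finsupp.single (⟨i, j, p⟩ : AllPaths I) 1

/-- The trivial path `e_i`. -/
def vtx (i : I) : PathAlgebra k I := ofPath k (Quiver.Path.nil : Quiver.Path i i)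

/-- An arrow, as an element of the path algebra. -/
def arr {i j : I} (α : i ⟶ j) : PathAlgebra k I := ofPath k α.toPath

open Classical in
/-- The product `q p` of two paths: "first `p`, then `q`" if `q` starts where `p` ends,
and zero otherwise.  So the path `α₁ α₂ ⋯ αₙ` traverses `αₙ` first. -/
def pathMul (q p : AllPaths I) : PathAlgebra k I :=
  if h : q.1 = p.2.1 then ofPath k (p.2.2.comp (q.2.2.cast h rfl)) else 0

/-- The product of the path algebra, as a bilinear map. -/
def mulLin : PathAlgebra k I →ₗ[k] PathAlgebra k I →ₗ[k] PathAlgebra k I :=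
  Finsupp.lift (PathAlgebra k I →ₗ[k] PathAlgebra k I) k (AllPaths I) fun q =>
    Finsupp.lift (PathAlgebra k I) k (AllPaths I) fun p => pathMul k q p

variable {k} in
theorem lin_ext {M : Type*} [AddCommGroup M] [Module k M] {f g : PathAlgebra k I →ₗ[k] M}
    (h : ∀ (i j : I) (p : Quiver.Path i j), f (ofPath k p) = g (ofPath k p)) : f = g :=
  Finsupp.lhom_ext' fun x => LinearMap.ext_ring (h x.1 x.2.1 x.2.2)

theorem lift_ofPath {M : Type*} [AddCommGroup M] [Module k M] (f : AllPaths I → M) {i j : I}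
    (p : Quiver.Path i j) : Finsupp.lift M k (AllPaths I) f (ofPath k p) = f ⟨i, j, p⟩ := by
  refine (Finsupp.lift_apply _ _ _ _ _).trans ?_
  exact (Finsupp.sum_single_index (h := fun x r => r • f x) (zero_smul k _)).trans (one_smul k _)

theorem mulLin_ofPath {a b c d : I} (q : Quiver.Path c d) (p : Quiver.Path a b) :
    mulLin k (ofPath k q) (ofPath k p) = pathMul k ⟨c, d, q⟩ ⟨a, b, p⟩ := by
  have h1 : mulLin k (ofPath k q) =
      Finsupp.lift (PathAlgebra k I) k (AllPaths I) fun p => pathMul k ⟨c, d, q⟩ p :=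
    lift_ofPath k _ q
  rw [h1]
  exact lift_ofPath k _ p

theorem mulLin_comp {a b c : I} (q : Quiver.Path b c) (p : Quiver.Path a b) :
    mulLin k (ofPath k q) (ofPath k p) = ofPath k (p.comp q) := by
  rw [mulLin_ofPath, pathMul, dif_pos rfl]
  rfl

theorem mulLin_ne {a b c d : I} (q : Quiver.Path c d) (p : Quiver.Path a b) (h : c ≠ b) :
    mulLin k (ofPath k q) (ofPath k p) = 0 := by
  rw [mulLin_ofPath, pathMul, dif_neg h]

theorem mulLin_assoc (x y z : PathAlgebra k I) :
    mulLin k (mulLin k x y) z = mulLin k x (mulLin k y z) := by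
  have h3 : ∀ (i j : I) (q : Quiver.Path i j) (i' j' : I) (p : Quiver.Path i' j')
      (z : PathAlgebra k I), mulLin k (mulLin k (ofPath k q) (ofPath k p)) z =
        mulLin k (ofPath k q) (mulLin k (ofPath k p) z) := by
    intro i j q i' j' p z
    have H : mulLin k (mulLin k (ofPath k q) (ofPath k p)) =
        (mulLin k (ofPath k q)).comp (mulLin k (ofPath k p)) := by
      refine lin_ext fun i'' j'' o => ?_
      rw [LinearMap.comp_apply]
      by_cases h1 : i = j'
      · subst h1
        rw [mulLin_comp]
        by_cases h2 : i' = j''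
        · subst h2
          rw [mulLin_comp, mulLin_comp, mulLin_comp, Quiver.Path.comp_assoc]
        · rw [mulLin_ne k _ _ h2, mulLin_ne k _ _ h2, map_zero]
      · rw [mulLin_ne k _ _ h1, map_zero, LinearMap.zero_apply]
        by_cases h2 : i' = j''
        · subst h2
          rw [mulLin_comp, mulLin_ne k _ _ h1]
        · rw [mulLin_ne k _ _ h2, map_zero]
    exact congr($H z)
  have h2 : ∀ (i j : I) (q : Quiver.Path i j) (y z : PathAlgebra k I),
      mulLin k (mulLin k (ofPath k q) y) z = mulLin k (ofPath k q) (mulLin k y z) := by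
    intro i j q y z
    have H : ((mulLin k).flip z).comp (mulLin k (ofPath k q)) =
        (mulLin k (ofPath k q)).comp ((mulLin k).flip z) :=
      lin_ext fun i' j' p => h3 i j q i' j' p z
    exact congr($H y)
  have H : ((mulLin k).flip z).comp ((mulLin k).flip y) = (mulLin k).flip (mulLin k y z) :=
    lin_ext fun i j q => h2 i j q y z
  exact congr($H x)

/-- The unit `∑ i, e_i` of the path algebra. -/
def oneElt (k : Type u) [Field k] (I : Type w) [Quiver.{t + 1} I] [Fintype I] : PathAlgebra k I :=
  ∑ i : I, vtx k i

theorem one_mulLin [Fintype I] (x : PathAlgebra k I) : mulLin k (oneElt k I) x = x := by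
  have H : mulLin k (oneElt k I) = LinearMap.id := by
    refine lin_ext fun i j p => ?_
    rw [oneElt, map_sum, LinearMap.sum_apply, Finset.sum_eq_single j]
    · exact mulLin_comp k _ p
    · intro b _ hb
      exact mulLin_ne k _ p hb
    · intro h
      exact absurd (Finset.mem_univ _) h
  exact congr($H x)

theorem mulLin_one [Fintype I] (x : PathAlgebra k I) : mulLin k x (oneElt k I) = x := by
  have H : (mulLin k).flip (oneElt k I) = LinearMap.id := by
    refine lin_ext fun i j p => ?_
    rw [LinearMap.flip_apply, oneElt, map_sum, Finset.sum_eq_single i]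
    · exact (mulLin_comp k p _).trans (by simp)
    · intro b _ hb
      exact mulLin_ne k p _ hb.symm
    · intro h
      exact absurd (Finset.mem_univ _) h
  exact congr($H x)

variable [Fintype I]

instance : Ring (PathAlgebra k I) where
  mul x y := mulLin k x y
  one := oneElt k I
  left_distrib x y z := (mulLin k x).map_add y z
  right_distrib x y z := (mulLin k).map_add₂ x y z
  zero_mul x := (mulLin k).map_zero₂ x
  mul_zero x := (mulLin k x).map_zero
  mul_assoc := mulLin_assoc k
  one_mul := one_mulLin k
  mul_one := mulLin_one k
  zsmul n x := n • x
  zsmul_zero' := SubNegMonoid.zsmul_zero'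
  zsmul_succ' := SubNegMonoid.zsmul_succ'
  zsmul_neg' := SubNegMonoid.zsmul_neg'
  neg_add_cancel := neg_add_cancel
  nsmul n x := n • x
  nsmul_zero := AddMonoid.nsmul_zero
  nsmul_succ := AddMonoid.nsmul_succ
  sub_eq_add_neg := sub_eq_add_neg

theorem mul_def (x y : PathAlgebra k I) : x * y = mulLin k x y := rfl

instance : Algebra k (PathAlgebra k I) :=
  Algebra.ofModule (fun r x y => (mulLin k).map_smul₂ r x y) fun r x y => (mulLin k x).map_smul r y

-- shortcuts for instance search
instance : Semiring (PathAlgebra k I) := Ring.toSemiring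

instance (J : Ideal (PathAlgebra k I)) [J.IsTwoSided] : Ring (PathAlgebra k I ⧸ J) :=
  Ideal.Quotient.ring J

instance (J : Ideal (PathAlgebra k I)) [J.IsTwoSided] : Semiring (PathAlgebra k I ⧸ J) :=
  (Ideal.Quotient.ring J).toSemiring

instance (J : Ideal (PathAlgebra k I)) [J.IsTwoSided] : Algebra k (PathAlgebra k I ⧸ J) :=
  Ideal.Quotient.algebra k

instance (J : Ideal (PathAlgebra k I)) [J.IsTwoSided] : SMul k (PathAlgebra k I ⧸ J) :=
  Algebra.toSMul

theorem ofPath_mul {a b c : I} (q : Quiver.Path b c) (p : Quiver.Path a b) :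
    ofPath k q * ofPath k p = ofPath k (p.comp q) := mulLin_comp k q p

theorem ofPath_mul_ne {a b c d : I} (q : Quiver.Path c d) (p : Quiver.Path a b) (h : c ≠ b) :
    ofPath k q * ofPath k p = 0 := mulLin_ne k q p h

variable (I) in
theorem countable_allPaths [∀ i j : I, Finite (i ⟶ j)] : Countable (AllPaths I) := by
  have h : ∀ n : ℕ, {x : AllPaths I | x.2.2.length = n}.Finite := by
    intro n
    induction n with
    | zero =>
      refine (Set.finite_range fun i : I => (⟨i, i, .nil⟩ : AllPaths I)).subset ?_
      rintro ⟨i, j, p⟩ hp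
      cases p with
      | nil => exact ⟨i, rfl⟩
      | cons p α => simp at hp
    | succ n ih =>
      have := ih.to_subtype
      refine (Set.finite_range
        fun y : (Σ x : {x : AllPaths I | x.2.2.length = n}, Σ j : I, (x.1.2.1 ⟶ j)) =>
          (⟨y.1.1.1, y.2.1, y.1.1.2.2.cons y.2.2⟩ : AllPaths I)).subset ?_
      rintro ⟨i, j, p⟩ hp
      cases p with
      | nil => simp at hp
      | cons p α => exact ⟨⟨⟨⟨i, _, p⟩, by simpa using hp⟩, _, α⟩, rfl⟩
  have h2 : (⋃ n : ℕ, {x : AllPaths I | x.2.2.length = n}) = Set.univ := by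
    ext x
    simp
  rw [← Set.countable_univ_iff, ← h2]
  exact Set.countable_iUnion fun n => (h n).countable

instance [∀ i j : I, Finite (i ⟶ j)] [Small.{v} k] : Small.{v} (PathAlgebra k I) := by
  have := countable_allPaths I
  change Small.{v} (AllPaths I →₀ k)
  exact small_of_injective (DFunLike.coe_injective (F := AllPaths I →₀ k))

instance [∀ i j : I, Finite (i ⟶ j)] [Small.{v} k] (J : Ideal (PathAlgebra k I)) :
    Small.{v} (PathAlgebra k I ⧸ J) :=
  small_of_surjective (Submodule.mkQ_surjective J)

end PathAlgebra

/-! ## Tensor products over a noncommutative ring -/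

section Tensor

/-- The relations `m a ⊗ n = m ⊗ a n` (`a ∈ R`) that define `M ⊗_R N` as a quotient of
`M ⊗_ℤ N`, for an `(S, R)`-bimodule `M` and a left `R`-module `N`.  Right `R`-modules are modules
over `Rᵐᵒᵖ`.  The set of the relations is stable under `S`, so that its `S`-span is also the
additive subgroup that it generates. -/
def balancedRel (S R M N : Type*) [Ring S] [Ring R] [AddCommGroup M] [Module S M] [Module Rᵐᵒᵖ M]
    [AddCommGroup N] [Module R N] : Submodule S (M ⊗[ℤ] N) :=
  Submodule.span S
    {z | ∃ (m : M) (a : R) (n : N), z = (MulOpposite.op a • m) ⊗ₜ[ℤ] n - m ⊗ₜ[ℤ] (a • n)}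

/-- The tensor product `M ⊗_R N`, as a left `S`-module, of an `(S, R)`-bimodule `M` and a left
`R`-module `N`.  (A right `R`-module is a `(ℤ, R)`-bimodule.) -/
abbrev BTensor (S R M N : Type*) [Ring S] [Ring R] [AddCommGroup M] [Module S M] [Module Rᵐᵒᵖ M]
    [AddCommGroup N] [Module R N] :=
  (M ⊗[ℤ] N) ⧸ balancedRel S R M N

variable (R M : Type*) [Ring R] [AddCommGroup M] [Module Rᵐᵒᵖ M]

/-- The map `id ⊗ f : M ⊗_R N → M ⊗_R N'`. -/
def BTensor.lMap {N N' : Type*} [AddCommGroup N] [Module R N] [AddCommGroup N'] [Module R N']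
    (f : N →ₗ[R] N') : BTensor ℤ R M N →ₗ[ℤ] BTensor ℤ R M N' :=
  Submodule.mapQ _ _ (f.toAddMonoidHom.toIntLinearMap.lTensor M) <| by
    rw [balancedRel, Submodule.span_le]
    rintro _ ⟨m, a, n, rfl⟩
    refine Submodule.subset_span ⟨m, a, f n, ?_⟩
    simp

end Tensor

/-- A right `R`-module `M` is flat if `M ⊗_R -` preserves injectivity of maps of left
`R`-modules. -/
def RightFlat (R : Type u) (M : Type v) [Ring R] [AddCommGroup M] [Module Rᵐᵒᵖ M] : Prop :=
  ∀ (N N' : Type u) [AddCommGroup N] [Module R N] [AddCommGroup N'] [Module R N']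
    (f : N →ₗ[R] N'), Function.Injective f → Function.Injective (BTensor.lMap R M f)

/-! ## The bimodules `J^r / J^(r+1)` -/

section Graded

variable {R : Type u} [Ring R] (J : Ideal R) [J.IsTwoSided] (r : ℕ)

/-- A two-sided ideal, as a right module. -/
def asRight : Submodule Rᵐᵒᵖ R where
  carrier := J
  add_mem' := J.add_mem
  zero_mem' := J.zero_mem
  smul_mem' a _ hx := J.mul_mem_right a.unop hx

/-- `J^r / J^(r+1)`. -/
def Gr : Type u := ↥(J ^ r) ⧸ (J ^ (r + 1)).submoduleOf (J ^ r)

instance : AddCommGroup (Gr J r) :=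
  inferInstanceAs (AddCommGroup (↥(J ^ r) ⧸ (J ^ (r + 1)).submoduleOf (J ^ r)))

instance : Module R (Gr J r) :=
  inferInstanceAs (Module R (↥(J ^ r) ⧸ (J ^ (r + 1)).submoduleOf (J ^ r)))

/-- The class in `J^r / J^(r+1)` of an element of `J^r`. -/
def Gr.mk : ↥(J ^ r) →ₗ[R] Gr J r := Submodule.mkQ _

theorem Gr.mk_surjective : Function.Surjective (Gr.mk J r) := Submodule.mkQ_surjective _

theorem Gr.mk_eq_zero (x : ↥(J ^ r)) (hx : (x : R) ∈ J ^ (r + 1)) : Gr.mk J r x = 0 :=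
  (Submodule.Quotient.mk_eq_zero _).2 hx

/-- Right multiplication by `a` on `J^r`. -/
def rightMulPow (a : R) : ↥(J ^ r) →ₗ[R] ↥(J ^ r) where
  toFun x := ⟨x * a, (J ^ r).mul_mem_right a x.2⟩
  map_add' _ _ := Subtype.ext (add_mul _ _ _)
  map_smul' _ _ := Subtype.ext (mul_assoc _ _ _)

/-- Right multiplication by `a` on `J^r / J^(r+1)`. -/
def Gr.rightMul (a : R) : Gr J r →ₗ[R] Gr J r :=
  Submodule.mapQ _ _ (rightMulPow J r a) fun _ hx => (J ^ (r + 1)).mul_mem_right a hx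

theorem Gr.rightMul_mk (a : R) (x : ↥(J ^ r)) :
    Gr.rightMul J r a (Gr.mk J r x) = Gr.mk J r (rightMulPow J r a x) := rfl

/-- Right multiplication as a ring homomorphism from `R / J`. -/
def Gr.rightAct : (R ⧸ J) →+* (Module.End R (Gr J r))ᵐᵒᵖ :=
  Ideal.Quotient.lift J
    { toFun := fun a => MulOpposite.op (Gr.rightMul J r a)
      map_one' := by
        refine MulOpposite.unop_injective (LinearMap.ext fun y => ?_)
        obtain ⟨x, rfl⟩ := Gr.mk_surjective J r y
        exact congrArg (Gr.mk J r) (Subtype.ext (mul_one _))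
      map_zero' := by
        refine MulOpposite.unop_injective (LinearMap.ext fun y => ?_)
        obtain ⟨x, rfl⟩ := Gr.mk_surjective J r y
        exact (congrArg (Gr.mk J r) (Subtype.ext (mul_zero _))).trans (map_zero _)
      map_add' := fun a b => by
        refine MulOpposite.unop_injective (LinearMap.ext fun y => ?_)
        obtain ⟨x, rfl⟩ := Gr.mk_surjective J r y
        exact (congrArg (Gr.mk J r) (Subtype.ext (mul_add _ _ _))).trans (map_add _ _ _)
      map_mul' := fun a b => by
        refine MulOpposite.unop_injective (LinearMap.ext fun y => ?_)
        obtain ⟨x, rfl⟩ := Gr.mk_surjective J r y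
        exact congrArg (Gr.mk J r) (Subtype.ext (mul_assoc _ _ _).symm) }
    (by
      intro a ha
      refine MulOpposite.unop_injective (LinearMap.ext fun y => ?_)
      obtain ⟨x, rfl⟩ := Gr.mk_surjective J r y
      refine Gr.mk_eq_zero J r _ ?_
      rw [Submodule.pow_succ]
      exact Ideal.mul_mem_mul x.2 ha)

theorem Gr.isTorsion : Module.IsTorsionBySet R (Gr J r) J := by
  intro y a
  obtain ⟨x, rfl⟩ := Gr.mk_surjective J r y
  rw [← map_smul]
  refine Gr.mk_eq_zero J r _ ?_
  rw [Ideal.IsTwoSided.pow_succ]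
  exact Ideal.mul_mem_mul a.2 x.2

/-- The left `R / J`-module structure: `a̅ • [x] = [a x]`. -/
instance : Module (R ⧸ J) (Gr J r) := (Gr.isTorsion J r).module

/-- The right `R / J`-module structure: `[x] • a̅ = [x a]`. -/
instance : Module (R ⧸ J)ᵐᵒᵖ (Gr J r) where
  smul a y := (Gr.rightAct J r a.unop).unop y
  one_smul y := by
    change (Gr.rightAct J r 1).unop y = y
    rw [map_one]; rfl
  mul_smul a b y := by
    change (Gr.rightAct J r (b.unop * a.unop)).unop y = _
    rw [map_mul]; rfl
  smul_zero a := map_zero _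
  smul_add a := map_add _
  add_smul a b y := by
    change (Gr.rightAct J r (a.unop + b.unop)).unop y = _
    rw [map_add]; rfl
  zero_smul y := by
    change (Gr.rightAct J r 0).unop y = 0
    rw [map_zero]; rfl

theorem Gr.mk_smul (a : R) (x : ↥(J ^ r)) :
    Ideal.Quotient.mk J a • Gr.mk J r x = Gr.mk J r (a • x) := rfl

theorem Gr.op_mk_smul (a : R) (x : ↥(J ^ r)) :
    MulOpposite.op (Ideal.Quotient.mk J a) • Gr.mk J r x = Gr.mk J r (rightMulPow J r a x) := rfl

section Scalars

variable (k : Type*) [Field k] [Algebra k R]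

instance : Module k (Gr J r) :=
  inferInstanceAs (Module k (↥(J ^ r) ⧸ (J ^ (r + 1)).submoduleOf (J ^ r)))

instance : IsScalarTower k R (Gr J r) :=
  inferInstanceAs (IsScalarTower k R (↥(J ^ r) ⧸ (J ^ (r + 1)).submoduleOf (J ^ r)))

instance : IsScalarTower k (R ⧸ J) (Gr J r) := (Gr.isTorsion J r).isScalarTower

end Scalars

/-- The left `A`-module `A^r ⊗_A V`, where `A = R / J` and `A^r = J^r / J^(r+1)`. -/
def GrTensor (V : Type*) [AddCommGroup V] [Module (R ⧸ J) V] :=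
  BTensor (R ⧸ J) (R ⧸ J) (Gr J r) V

section Instances

variable (V : Type*) [AddCommGroup V] [Module (R ⧸ J) V]

instance : AddCommGroup (GrTensor J r V) :=
  inferInstanceAs (AddCommGroup (BTensor (R ⧸ J) (R ⧸ J) (Gr J r) V))

instance : Module (R ⧸ J) (GrTensor J r V) :=
  inferInstanceAs (Module (R ⧸ J) (BTensor (R ⧸ J) (R ⧸ J) (Gr J r) V))

variable (k : Type*) [Field k] [Algebra k R]

instance : Module k (GrTensor J r V) :=
  inferInstanceAs (Module k (BTensor (R ⧸ J) (R ⧸ J) (Gr J r) V))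

instance : IsScalarTower k (R ⧸ J) (GrTensor J r V) :=
  inferInstanceAs (IsScalarTower k (R ⧸ J) (BTensor (R ⧸ J) (R ⧸ J) (Gr J r) V))

end Instances

/-- The canonical projection `A^r ⊗_ℤ V → A^r ⊗_A V`. -/
def GrTensor.proj (V : Type*) [AddCommGroup V] [Module (R ⧸ J) V] :
    Gr J r ⊗[ℤ] V →ₗ[R ⧸ J] GrTensor J r V :=
  (balancedRel (R ⧸ J) (R ⧸ J) (Gr J r) V).mkQ

/-- The element `[x] ⊗ v` of `A^r ⊗_A V`, for `x ∈ J^r` and `v ∈ V`. -/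
def GrTensor.tmul {V : Type*} [AddCommGroup V] [Module (R ⧸ J) V] (x : ↥(J ^ r)) (v : V) :
    GrTensor J r V :=
  GrTensor.proj J r V (Gr.mk J r x ⊗ₜ[ℤ] v)

theorem GrTensor.smul_tmul {V : Type*} [AddCommGroup V] [Module (R ⧸ J) V] (a : R) (x : ↥(J ^ r))
    (v : V) : Ideal.Quotient.mk J a • GrTensor.tmul J r x v = GrTensor.tmul J r (a • x) v := rfl

theorem GrTensor.tmul_smul {V : Type*} [AddCommGroup V] [Module (R ⧸ J) V] (a : R) (x : ↥(J ^ r))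
    (v : V) : GrTensor.tmul J r x (Ideal.Quotient.mk J a • v) =
      GrTensor.tmul J r (rightMulPow J r a x) v := by
  refine ((Submodule.Quotient.eq _).2 (Submodule.subset_span ?_)).symm
  exact ⟨Gr.mk J r x, Ideal.Quotient.mk J a, v, by rw [Gr.op_mk_smul]⟩

theorem GrTensor.induction {V : Type*} [AddCommGroup V] [Module (R ⧸ J) V]
    {p : GrTensor J r V → Prop} (h0 : p 0) (hadd : ∀ x y, p x → p y → p (x + y))
    (h : ∀ x v, p (GrTensor.tmul J r x v)) (z : GrTensor J r V) : p z := by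
  obtain ⟨z, rfl⟩ : ∃ y, GrTensor.proj J r V y = z := Submodule.mkQ_surjective _ z
  induction z with
  | zero => exact h0
  | tmul y v =>
    obtain ⟨x, rfl⟩ := Gr.mk_surjective J r y
    exact h x v
  | add x y hx hy => exact hadd _ _ hx hy

end Graded

/-! ## Derivations of the path algebra -/

section Deriv

variable {k : Type u} [Field k] {I : Type w} [Quiver.{t + 1} I] [Fintype I]
variable {N N' : Type*} [AddCommGroup N] [Module k N] [AddCommGroup N'] [Module k N']
variable (ρ : PathAlgebra k I →ₐ[k] Module.End k N) (σ : PathAlgebra k I →ₐ[k] Module.End k N')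
variable (g : ∀ ⦃i j : I⦄, (i ⟶ j) → (N →ₗ[k] N'))

/-- For two representations `N`, `N'` of the path algebra and maps `g_α : N → N'`, the map
`∑_m α₁ ⋯ α_{m-1} ∘ g_{α_m} ∘ α_{m+1} ⋯ αₙ : N → N'` attached to a path `α₁ ⋯ αₙ`. -/
def pathDeriv {i : I} : ∀ {j : I}, Quiver.Path i j → (N →ₗ[k] N')
  | _, .nil => 0
  | _, .cons p α => σ (arr k α) ∘ₗ pathDeriv p + g α ∘ₗ ρ (ofPath k p)

/-- The linear extension of `pathDeriv` to the path algebra (the derivation with values in the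
bimodule `Hom_k(N, N')` that maps each trivial path to `0` and each arrow `α` to `g_α`). -/
def deriv : PathAlgebra k I →ₗ[k] (N →ₗ[k] N') :=
  Finsupp.lift (N →ₗ[k] N') k (AllPaths I) fun p => pathDeriv ρ σ g p.2.2

theorem deriv_ofPath {i j : I} (p : Quiver.Path i j) :
    deriv ρ σ g (ofPath k p) = pathDeriv ρ σ g p := lift_ofPath k _ p

theorem deriv_vtx (i : I) : deriv ρ σ g (vtx k i) = 0 := deriv_ofPath ρ σ g _

theorem ofPath_cons {i j l : I} (p : Quiver.Path i j) (α : j ⟶ l) :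
    ofPath k (p.cons α) = arr k α * ofPath k p := (ofPath_mul k α.toPath p).symm

theorem vtx_mul_ofPath {i j : I} (p : Quiver.Path i j) : vtx k j * ofPath k p = ofPath k p :=
  ofPath_mul k _ _

theorem arr_mul_vtx {i j : I} (α : i ⟶ j) : arr k α * vtx k i = arr k α :=
  (ofPath_mul k _ _).trans (by rw [Quiver.Path.nil_comp]; rfl)

theorem vtx_mul_arr {i j : I} (α : i ⟶ j) : vtx k j * arr k α = arr k α :=
  vtx_mul_ofPath _

theorem vtx_mul_vtx (i : I) : vtx k i * vtx k i = vtx k i := vtx_mul_ofPath _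

theorem vtx_mul_vtx_ne {i j : I} (h : i ≠ j) : vtx k i * vtx k j = 0 := ofPath_mul_ne k _ _ h

theorem deriv_add_maps (g' : ∀ ⦃i j : I⦄, (i ⟶ j) → (N →ₗ[k] N')) :
    deriv ρ σ (fun _ _ α => g α + g' α) = deriv ρ σ g + deriv ρ σ g' := by
  refine lin_ext fun i j p => ?_
  rw [LinearMap.add_apply, deriv_ofPath, deriv_ofPath, deriv_ofPath]
  induction p with
  | nil => simp [pathDeriv]
  | cons p α ih =>
    rw [pathDeriv, pathDeriv, pathDeriv, ih, LinearMap.comp_add, LinearMap.add_comp]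
    abel

theorem deriv_smul_maps (c : k) :
    deriv ρ σ (fun _ _ α => c • g α) = c • deriv ρ σ g := by
  refine lin_ext fun i j p => ?_
  rw [LinearMap.smul_apply, deriv_ofPath, deriv_ofPath]
  induction p with
  | nil => simp [pathDeriv]
  | cons p α ih =>
    rw [pathDeriv, pathDeriv, ih, LinearMap.comp_smul, LinearMap.smul_comp, smul_add]

theorem vtx_deriv (hσ : ∀ ⦃i j : I⦄ (α : i ⟶ j), σ (vtx k j) ∘ₗ g α = g α)
    {i j : I} (p : Quiver.Path i j) :
    σ (vtx k j) ∘ₗ deriv ρ σ g (ofPath k p) = deriv ρ σ g (ofPath k p) := by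
  rw [deriv_ofPath]
  cases p with
  | nil => simp [pathDeriv]
  | cons p α =>
    rw [pathDeriv, LinearMap.comp_add, ← LinearMap.comp_assoc, ← LinearMap.comp_assoc, hσ,
      ← Module.End.mul_eq_comp, ← map_mul, vtx_mul_arr]

theorem deriv_vtx_mul (hσ : ∀ ⦃i j : I⦄ (α : i ⟶ j), σ (vtx k j) ∘ₗ g α = g α)
    (c : I) (y : PathAlgebra k I) :
    deriv ρ σ g (vtx k c * y) = σ (vtx k c) ∘ₗ deriv ρ σ g y := by
  have H : (deriv ρ σ g).comp (mulLin k (vtx k c)) =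
      (LinearMap.llcomp k N N' N' (σ (vtx k c))).comp (deriv ρ σ g) := by
    refine lin_ext fun a b p => ?_
    change deriv ρ σ g (vtx k c * ofPath k p) = σ (vtx k c) ∘ₗ deriv ρ σ g (ofPath k p)
    by_cases h : c = b
    · subst h
      rw [vtx_mul_ofPath, vtx_deriv ρ σ g hσ]
    · rw [vtx, ofPath_mul_ne k _ _ h, map_zero, ← vtx_deriv ρ σ g hσ p, ← LinearMap.comp_assoc,
        ← Module.End.mul_eq_comp, ← map_mul, ← vtx, vtx_mul_vtx_ne h, map_zero,
        LinearMap.zero_comp]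
  exact congr($H y)

theorem deriv_arr_mul (hρ : ∀ ⦃i j : I⦄ (α : i ⟶ j), g α ∘ₗ ρ (vtx k i) = g α)
    (hσ : ∀ ⦃i j : I⦄ (α : i ⟶ j), σ (vtx k j) ∘ₗ g α = g α)
    {c d : I} (α : c ⟶ d) (y : PathAlgebra k I) :
    deriv ρ σ g (arr k α * y) = σ (arr k α) ∘ₗ deriv ρ σ g y + g α ∘ₗ ρ y := by
  have H : (deriv ρ σ g).comp (mulLin k (arr k α)) =
      (LinearMap.llcomp k N N' N' (σ (arr k α))).comp (deriv ρ σ g) +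
        (LinearMap.llcomp k N N N' (g α)).comp ρ.toLinearMap := by
    refine lin_ext fun a b p => ?_
    change deriv ρ σ g (arr k α * ofPath k p) =
      σ (arr k α) ∘ₗ deriv ρ σ g (ofPath k p) + g α ∘ₗ ρ (ofPath k p)
    by_cases h : c = b
    · subst h
      rw [← ofPath_cons, deriv_ofPath, deriv_ofPath, pathDeriv]
    · have h1 : arr k α * vtx k b = 0 := ofPath_mul_ne k _ _ h
      rw [arr, ofPath_mul_ne k _ _ h, map_zero, ← vtx_deriv ρ σ g hσ p, ← LinearMap.comp_assoc,
        ← Module.End.mul_eq_comp, ← map_mul, ← arr, h1, map_zero, LinearMap.zero_comp, ← hρ,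
        LinearMap.comp_assoc, ← Module.End.mul_eq_comp, ← map_mul, vtx, ofPath_mul_ne k _ _ h,
        map_zero, LinearMap.comp_zero, add_zero]
  exact congr($H y)

theorem deriv_mul (hρ : ∀ ⦃i j : I⦄ (α : i ⟶ j), g α ∘ₗ ρ (vtx k i) = g α)
    (hσ : ∀ ⦃i j : I⦄ (α : i ⟶ j), σ (vtx k j) ∘ₗ g α = g α)
    (x y : PathAlgebra k I) :
    deriv ρ σ g (x * y) = σ x ∘ₗ deriv ρ σ g y + deriv ρ σ g x ∘ₗ ρ y := by
  have H : (deriv ρ σ g).comp ((mulLin k).flip y) =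
      (LinearMap.llcomp k N N' N').flip (deriv ρ σ g y) ∘ₗ σ.toLinearMap +
        (LinearMap.llcomp k N N N').flip (ρ y) ∘ₗ deriv ρ σ g := by
    refine lin_ext fun a b q => ?_
    change deriv ρ σ g (ofPath k q * y) =
      σ (ofPath k q) ∘ₗ deriv ρ σ g y + deriv ρ σ g (ofPath k q) ∘ₗ ρ y
    induction q with
    | nil =>
      rw [← vtx, deriv_vtx_mul ρ σ g hσ, deriv_vtx, LinearMap.zero_comp, add_zero]
    | cons q α ih =>
      rw [ofPath_cons, mul_assoc, deriv_arr_mul ρ σ g hρ hσ, deriv_arr_mul ρ σ g hρ hσ, ih,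
        map_mul, map_mul]
      ext n
      simp [add_assoc]
  exact congr($H x)

end Deriv

/-! ## The complex -/

section Complex

variable {k : Type u} [Field k] {I : Type w} [Quiver.{t + 1} I] [Fintype I]
variable (J : Ideal (PathAlgebra k I)) [J.IsTwoSided]

section Rep

variable (X : Type*) [AddCommGroup X] [Module (PathAlgebra k I ⧸ J) X] [Module k X]
  [IsScalarTower k (PathAlgebra k I ⧸ J) X]

/-- The action of the path algebra on a left module over `A = kQ / J`. -/
def rep : PathAlgebra k I →ₐ[k] Module.End k X :=
  (Algebra.lsmul k k X).comp (Ideal.Quotient.mkₐ k J)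

variable {X} in
theorem rep_apply (a : PathAlgebra k I) (x : X) : rep J X a x = Ideal.Quotient.mk J a • x := rfl

theorem rep_eq_zero {a : PathAlgebra k I} (ha : a ∈ J) : rep J X a = 0 := by
  ext x
  rw [rep_apply, Ideal.Quotient.eq_zero_iff_mem.2 ha, zero_smul, LinearMap.zero_apply]

/-- The component `X_i = e_i X` of a left `A`-module `X`. -/
def vpart (i : I) : Submodule k X := LinearMap.range (rep J X (vtx k i))

/-- The projection `x ↦ e_i x` of `X` onto `X_i`. -/
def vproj (i : I) : X →ₗ[k] vpart J X i := (rep J X (vtx k i)).rangeRestrict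

/-- The map `X_{t(α)} → X_{h(α)}`, `x ↦ α x`, given by an arrow `α`. -/
def arrMap {i j : I} (α : i ⟶ j) : vpart J X i →ₗ[k] vpart J X j :=
  (rep J X (arr k α)).restrict fun x _ => ⟨rep J X (arr k α) x, by
    rw [← Module.End.mul_apply, ← map_mul, vtx_mul_arr]⟩

theorem vproj_coe {i : I} (x : vpart J X i) : vproj J X i x = x := by
  obtain ⟨_, y, rfl⟩ := x
  refine Subtype.ext ?_
  change rep J X (vtx k i) (rep J X (vtx k i) y) = _
  rw [← Module.End.mul_apply, ← map_mul, vtx_mul_vtx]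

end Rep

variable (r : ℕ) (V : Type v) [AddCommGroup V] [Module (PathAlgebra k I ⧸ J) V]
variable (W : Type v) [AddCommGroup W] [Module (PathAlgebra k I ⧸ J) W] [Module k W]
  [IsScalarTower k (PathAlgebra k I ⧸ J) W]

/-- `C^{2r}(V, W) = ⨁_i Hom_k((A^r ⊗_A V)_i, W_i)`. -/
abbrev EvenCochain :=
  ∀ i : I, vpart J (GrTensor J r V) i →ₗ[k] vpart J W i

/-- `C^{2r+1}(V, W) = ⨁_α Hom_k((A^r ⊗_A V)_{t(α)}, W_{h(α)})`, where `α` runs over the arrows. -/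
abbrev OddCochain :=
  ∀ (i j : I) (_ : i ⟶ j), vpart J (GrTensor J r V) i →ₗ[k] vpart J W j

/-- The differential `C^{2r} → C^{2r+1}`,
`(f_i)_i ↦ (f_{h(α)} ∘ α - α ∘ f_{t(α)})_α`. -/
def dEven : EvenCochain J r V W →ₗ[k] OddCochain J r V W where
  toFun f := fun i j α => f j ∘ₗ arrMap J _ α - arrMap J W α ∘ₗ f i
  map_add' f f' := by
    funext i j α
    simp only [Pi.add_apply, LinearMap.add_comp, LinearMap.comp_add]
    abel
  map_smul' c f := by
    funext i j α
    simp only [Pi.smul_apply, LinearMap.smul_comp, LinearMap.comp_smul, smul_sub,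
      RingHom.id_apply]

variable {J r V W}

/-- The maps `A^r ⊗_A V → W`, `x ↦ g_α(e_{t(α)} x)`. -/
def OddCochain.ext (g : OddCochain J r V W) ⦃i j : I⦄ (α : i ⟶ j) : GrTensor J r V →ₗ[k] W :=
  (vpart J W j).subtype ∘ₗ g i j α ∘ₗ vproj J _ i

/-- The derivation `D_g : kQ → Hom_k(A^r ⊗_A V, W)` with `D_g(e_i) = 0` and `D_g(α) = g_α`. -/
def OddCochain.deriv (g : OddCochain J r V W) :
    PathAlgebra k I →ₗ[k] (GrTensor J r V →ₗ[k] W) :=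
  QuiverExt.deriv (rep J (GrTensor J r V)) (rep J W) g.ext

theorem OddCochain.deriv_add (g g' : OddCochain J r V W) :
    (g + g').deriv = g.deriv + g'.deriv := by
  refine Eq.trans ?_ (deriv_add_maps (rep J (GrTensor J r V)) (rep J W) g.ext g'.ext)
  refine congrArg (QuiverExt.deriv _ _) ?_
  funext i j α
  exact LinearMap.ext fun x => rfl

theorem OddCochain.deriv_smul (c : k) (g : OddCochain J r V W) :
    (c • g).deriv = c • g.deriv := by
  refine Eq.trans ?_ (deriv_smul_maps (rep J (GrTensor J r V)) (rep J W) g.ext c)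
  refine congrArg (QuiverExt.deriv _ _) ?_
  funext i j α
  exact LinearMap.ext fun x => rfl

/-- The product `s x ∈ J^(r+1)` of `s ∈ J` and `x ∈ J^r`. -/
def mulPow (s : J) (x : ↥(J ^ r)) : ↥(J ^ (r + 1)) :=
  ⟨s * x, by rw [Ideal.IsTwoSided.pow_succ]; exact Ideal.mul_mem_mul s.2 x.2⟩

theorem mem_pow_succ_induction {p : ↥(J ^ (r + 1)) → Prop}
    (hadd : ∀ x y, p x → p y → p (x + y)) (h : ∀ (s : J) (x : ↥(J ^ r)), p (mulPow s x))
    (y : ↥(J ^ (r + 1))) : p y := by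
  obtain ⟨y, hy⟩ := y
  have hy' : y ∈ J * J ^ r := by rwa [← Ideal.IsTwoSided.pow_succ]
  suffices H : ∃ hy : y ∈ J ^ (r + 1), p ⟨y, hy⟩ from H.2
  refine Submodule.smul_induction_on hy' (fun s hs x hx => ?_) ?_
  · exact ⟨_, h ⟨s, hs⟩ ⟨x, hx⟩⟩
  · rintro x y ⟨hx, hx'⟩ ⟨hy, hy'⟩
    exact ⟨add_mem hx hy, hadd _ _ hx' hy'⟩

theorem GrTensor.tmul_add_left {r : ℕ} (x y : ↥(J ^ r)) (v : V) :
    GrTensor.tmul J r (x + y) v = GrTensor.tmul J r x v + GrTensor.tmul J r y v := by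
  rw [GrTensor.tmul, map_add, TensorProduct.add_tmul, map_add]
  rfl

theorem connecting_unique {δ δ' : GrTensor J (r + 1) V →ₗ[PathAlgebra k I ⧸ J] W}
    (h : ∀ (s : J) (x : ↥(J ^ r)) (v : V), δ (GrTensor.tmul J (r + 1) (mulPow s x) v) =
      δ' (GrTensor.tmul J (r + 1) (mulPow s x) v)) : δ = δ' := by
  refine LinearMap.ext fun z => ?_
  refine GrTensor.induction J (r + 1) (p := fun z => δ z = δ' z) ?_ ?_ ?_ z
  · rw [map_zero, map_zero]
  · intro x y hx hy
    rw [map_add, map_add, hx, hy]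
  · intro x v
    refine mem_pow_succ_induction (p := fun x => δ (GrTensor.tmul J (r + 1) x v) =
      δ' (GrTensor.tmul J (r + 1) x v)) ?_ (fun s x => h s x v) x
    intro x y hx hy
    rw [GrTensor.tmul_add_left, map_add, map_add, hx, hy]

theorem OddCochain.rep_ext (g : OddCochain J r V W) ⦃i j : I⦄ (α : i ⟶ j) :
    rep J W (vtx k j) ∘ₗ g.ext α = g.ext α := by
  refine LinearMap.ext fun x => ?_
  change ((vproj J W j (g i j α (vproj J _ i x)) : vpart J W j) : W) = _
  rw [vproj_coe]
  rfl

theorem exists_retraction (J : Ideal (PathAlgebra k I)) :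
    ∃ p : PathAlgebra k I →ₗ[k] ↥J, ∀ x : ↥J, p x = x := by
  obtain ⟨p, hp⟩ := (J.subtype.restrictScalars k).exists_leftInverse_of_injective
    (LinearMap.ker_eq_bot.2 Subtype.val_injective)
  exact ⟨p, fun x => congr($hp x)⟩

/-- A solution `f` on `J^r` of `f_{h(α)}(α x)(v) - α f_{t(α)}(x)(v) = g_α([x] ⊗ v)`. -/
theorem exists_aux (g : OddCochain J r V W) :
    ∃ f : PathAlgebra k I → V → W, (∀ x y v, f (x + y) v = f x v + f y v) ∧
      (∀ x v v', f x (v + v') = f x v + f x v') ∧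
      ∀ (s : PathAlgebra k I) (x : ↥(J ^ r)) (v : V),
        f (s * x) v = Ideal.Quotient.mk J s • f x v + g.deriv s (GrTensor.tmul J r x v) := by
  obtain ⟨p, hp⟩ := exists_retraction (J ^ r)
  let ρ : PathAlgebra k I →ₐ[k] Module.End k (PathAlgebra k I ⊗[ℤ] V) := Algebra.lsmul k k _
  let θ : PathAlgebra k I ⊗[ℤ] V →ₗ[k] GrTensor J r V :=
    ((GrTensor.proj J r V).restrictScalars k) ∘ₗ
      TensorProduct.AlgebraTensorModule.map ((Gr.mk J r).restrictScalars k ∘ₗ p) LinearMap.id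
  have hθ : ∀ (x : ↥(J ^ r)) (v : V), θ ((x : PathAlgebra k I) ⊗ₜ v) = GrTensor.tmul J r x v := by
    intro x v
    change GrTensor.tmul J r (p x) v = _
    rw [hp]
  let G : ∀ ⦃i j : I⦄, (i ⟶ j) → (PathAlgebra k I ⊗[ℤ] V →ₗ[k] W) := fun i j α =>
    g.ext α ∘ₗ θ ∘ₗ ρ (vtx k i)
  have hG : ∀ ⦃i j : I⦄ (α : i ⟶ j), G α ∘ₗ ρ (vtx k i) = G α := by
    intro i j α
    change (g.ext α ∘ₗ θ ∘ₗ ρ (vtx k i)) ∘ₗ ρ (vtx k i) = g.ext α ∘ₗ θ ∘ₗ ρ (vtx k i)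
    rw [LinearMap.comp_assoc, LinearMap.comp_assoc, ← Module.End.mul_eq_comp, ← map_mul,
      vtx_mul_vtx]
  have hG' : ∀ ⦃i j : I⦄ (α : i ⟶ j), rep J W (vtx k j) ∘ₗ G α = G α := by
    intro i j α
    change rep J W (vtx k j) ∘ₗ (g.ext α ∘ₗ θ ∘ₗ ρ (vtx k i)) = g.ext α ∘ₗ θ ∘ₗ ρ (vtx k i)
    rw [← LinearMap.comp_assoc, OddCochain.rep_ext]
  have key : ∀ (x : ↥(J ^ r)) (v : V) (s : PathAlgebra k I),
      deriv ρ (rep J W) G s ((x : PathAlgebra k I) ⊗ₜ v) =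
        g.deriv s (GrTensor.tmul J r x v) := by
    intro x v s
    have H : (LinearMap.applyₗ ((x : PathAlgebra k I) ⊗ₜ[ℤ] v)).comp (deriv ρ (rep J W) G) =
        (LinearMap.applyₗ (GrTensor.tmul J r x v)).comp g.deriv := by
      refine lin_ext fun i j q => ?_
      change deriv ρ (rep J W) G (ofPath k q) ((x : PathAlgebra k I) ⊗ₜ v) =
        g.deriv (ofPath k q) (GrTensor.tmul J r x v)
      rw [OddCochain.deriv, deriv_ofPath, deriv_ofPath]
      induction q with
      | nil => rfl
      | cons q α ih =>
        rw [pathDeriv, pathDeriv, LinearMap.add_apply, LinearMap.add_apply, LinearMap.comp_apply,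
          LinearMap.comp_apply, ih]
        congr 1
        change g.ext α (θ ((vtx k _ * (ofPath k q * (x : PathAlgebra k I))) ⊗ₜ[ℤ] v)) =
          g.ext α (GrTensor.tmul J r (ofPath k q • x) v)
        rw [← mul_assoc, vtx_mul_ofPath, ← hθ]
        rfl
    exact congr($H s)
  refine ⟨fun y v => deriv ρ (rep J W) G y (1 ⊗ₜ v), ?_, ?_, ?_⟩
  · intro x y v
    beta_reduce
    rw [map_add, LinearMap.add_apply]
  · intro x v v'
    beta_reduce
    rw [TensorProduct.tmul_add, map_add]
  · intro s x v
    change deriv ρ (rep J W) G (s * x) (1 ⊗ₜ v) = _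
    rw [deriv_mul ρ (rep J W) G hG hG', LinearMap.add_apply, LinearMap.comp_apply, rep_apply,
      LinearMap.comp_apply, ← key]
    congr 2
    change ((x : PathAlgebra k I) * 1) ⊗ₜ[ℤ] v = _
    rw [mul_one]

theorem exists_connecting (g : OddCochain J r V W) :
    ∃ δ : GrTensor J (r + 1) V →ₗ[PathAlgebra k I ⧸ J] W, ∀ (s : J) (x : ↥(J ^ r)) (v : V),
      δ (GrTensor.tmul J (r + 1) (mulPow s x) v) = g.deriv s (GrTensor.tmul J r x v) := by
  obtain ⟨f, hf, hf', hfs⟩ := exists_aux g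
  -- on products `s x` with `s ∈ J`, the value of `f` is given by the derivation
  have hJ : ∀ (s : J) (x : ↥(J ^ r)) (v : V),
      f (mulPow s x : ↥(J ^ (r + 1))) v = g.deriv s (GrTensor.tmul J r x v) := by
    intro s x v
    change f ((s : PathAlgebra k I) * x) v = _
    rw [hfs, Ideal.Quotient.eq_zero_iff_mem.2 s.2, zero_smul, zero_add]
  let _ : Module (PathAlgebra k I) W := Module.compHom W (Ideal.Quotient.mk J)
  -- `f` is left linear on `J^(r+1)`
  have hlin : ∀ (a : PathAlgebra k I) (y : ↥(J ^ (r + 1))) (v : V),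
      f (a * y) v = Ideal.Quotient.mk J a • f y v := by
    intro a y v
    refine mem_pow_succ_induction (p := fun y : ↥(J ^ (r + 1)) => f (a * y) v = Ideal.Quotient.mk J a • f y v)
      ?_ ?_ y
    · intro x y hx hy
      change f (a * (x + y)) v = Ideal.Quotient.mk J a • f (x + y) v
      rw [mul_add, hf, hf, hx, hy, smul_add]
    · intro s x
      change f (a * (s * x)) v = Ideal.Quotient.mk J a • f ((mulPow s x : ↥(J ^ (r + 1)))) v
      rw [← mul_assoc]
      refine (hJ ⟨a * s, J.mul_mem_left a s.2⟩ x v).trans ?_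
      have h1 := hfs a (⟨s * x, (J ^ r).mul_mem_left _ x.2⟩) v
      have h2 : GrTensor.tmul J r (⟨s * x, (J ^ r).mul_mem_left _ x.2⟩ : ↥(J ^ r)) v = 0 := by
        rw [GrTensor.tmul, Gr.mk_eq_zero J r _ (mulPow s x).2, TensorProduct.zero_tmul,
          map_zero]
      rw [h2, map_zero, add_zero] at h1
      refine Eq.trans ?_ h1
      change _ = f (a * (s * x)) v
      rw [← mul_assoc]
      exact (hJ ⟨a * s, J.mul_mem_left a s.2⟩ x v).symm
  -- `f` is balanced on `J^(r+1)`
  have hbal : ∀ (a : PathAlgebra k I) (y : ↥(J ^ (r + 1))) (v : V),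
      f (y * a) v = f y (Ideal.Quotient.mk J a • v) := by
    intro a y v
    refine mem_pow_succ_induction (p := fun y : ↥(J ^ (r + 1)) => f (y * a) v = f y (Ideal.Quotient.mk J a • v))
      ?_ ?_ y
    · intro x y hx hy
      change f ((x + y) * a) v = f (x + y) (Ideal.Quotient.mk J a • v)
      rw [add_mul, hf, hf, hx, hy]
    · intro s x
      rw [hJ, GrTensor.tmul_smul, ← hJ]
      change f (s * x * a) v = f (s * (x * a)) v
      rw [mul_assoc]
  -- `f` vanishes on `J^(r+2)`
  have hvan : ∀ (y : ↥(J ^ (r + 1 + 1))) (v : V), f y v = 0 := by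
    intro y v
    have h0 : ∀ v, f 0 v = 0 := fun v => by simpa using hf 0 0 v
    refine mem_pow_succ_induction (p := fun y : ↥(J ^ (r + 1 + 1)) => f y v = 0) ?_ ?_ y
    · intro x y hx hy
      change f (x + y) v = 0
      rw [hf, hx, hy, add_zero]
    · intro s x
      change f (s * x) v = 0
      rw [hlin, Ideal.Quotient.eq_zero_iff_mem.2 s.2, zero_smul]
  let B0 : ↥(J ^ (r + 1)) →ₗ[PathAlgebra k I] (V →ₗ[ℤ] W) :=
    { toFun := fun y => (AddMonoidHom.mk' (f y) (hf' y)).toIntLinearMap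
      map_add' := fun x y => LinearMap.ext fun v => hf x y v
      map_smul' := fun a y => LinearMap.ext fun v => hlin a y v }
  let B : Gr J (r + 1) →ₗ[PathAlgebra k I] (V →ₗ[ℤ] W) :=
    Submodule.liftQ _ B0 fun y hy => LinearMap.ext fun v => hvan ⟨y, hy⟩ v
  let T : Gr J (r + 1) ⊗[ℤ] V →ₗ[PathAlgebra k I] W := TensorProduct.AlgebraTensorModule.lift B
  let T' : Gr J (r + 1) ⊗[ℤ] V →ₗ[PathAlgebra k I ⧸ J] W :=
    { toFun := T
      map_add' := T.map_add
      map_smul' := fun a z => by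
        obtain ⟨a, rfl⟩ := Ideal.Quotient.mk_surjective a
        refine Eq.trans (congrArg T ?_) (T.map_smul a z)
        induction z with
        | zero => rw [smul_zero, smul_zero]
        | tmul y v => rfl
        | add x y hx hy => rw [smul_add, smul_add, hx, hy] }
  refine ⟨(Submodule.liftQ (balancedRel (PathAlgebra k I ⧸ J) (PathAlgebra k I ⧸ J)
    (Gr J (r + 1)) V) T' ?_ : BTensor _ _ _ _ →ₗ[_] _), fun s x v => hJ s x v⟩
  rw [balancedRel, Submodule.span_le]
  rintro _ ⟨m, a, v, rfl⟩
  obtain ⟨y, rfl⟩ := Gr.mk_surjective J (r + 1) m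
  obtain ⟨a, rfl⟩ := Ideal.Quotient.mk_surjective a
  change T' _ = 0
  rw [map_sub, sub_eq_zero, Gr.op_mk_smul]
  exact hbal a y v

/-- The connecting map `A^{r+1} ⊗_A V → W` of `g`: the `A`-linear map with
`[s x] ⊗ v ↦ D_g(s)([x] ⊗ v)` for `s ∈ J`, `x ∈ J^r`, `v ∈ V`.  This is the connecting map of the
snake lemma for `0 → J^(r+1) → J^r → A^r → 0`: if `f : J^r → Hom(V, W)` is a solution of
`f(α x)(v) - α f(x)(v) = g_α([x] ⊗ v)`, then `f(s x)(v) = s f(x)(v) + D_g(s)([x] ⊗ v)`, where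
`s f(x)(v) = 0` for `s ∈ J`, so that the map is the restriction of `f` to `J^(r+1)`. -/
def connecting (g : OddCochain J r V W) : GrTensor J (r + 1) V →ₗ[PathAlgebra k I ⧸ J] W :=
  (exists_connecting g).choose

theorem connecting_tmul (g : OddCochain J r V W) (s : J) (x : ↥(J ^ r)) (v : V) :
    connecting g (GrTensor.tmul J (r + 1) (mulPow s x) v) = g.deriv s (GrTensor.tmul J r x v) :=
  (exists_connecting g).choose_spec s x v

theorem connecting_add (g g' : OddCochain J r V W) :
    connecting (g + g') = connecting g + connecting g' := by
  refine connecting_unique fun s x v => ?_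
  rw [LinearMap.add_apply, connecting_tmul, connecting_tmul, connecting_tmul,
    OddCochain.deriv_add]
  rfl

theorem connecting_smul (c : k) (g : OddCochain J r V W) :
    connecting (c • g) = c • connecting g := by
  refine connecting_unique fun s x v => ?_
  rw [LinearMap.smul_apply, connecting_tmul, connecting_tmul, OddCochain.deriv_smul]
  rfl

variable (J r V W)

/-- The differential `C^{2r+1} → C^{2r+2}`: the components `(A^{r+1} ⊗_A V)_i → W_i` of the
connecting map. -/
def dOdd : OddCochain J r V W →ₗ[k] EvenCochain J (r + 1) V W where
  toFun g := fun i => vproj J W i ∘ₗ (connecting g).restrictScalars k ∘ₗ Submodule.subtype _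
  map_add' g g' := by
    funext i
    rw [connecting_add]
    exact LinearMap.ext fun x => map_add (vproj J W i) _ _
  map_smul' c g := by
    funext i
    rw [connecting_smul]
    exact LinearMap.ext fun x => map_smul (vproj J W i) _ _

theorem dOdd_comp_dEven : dOdd J r V W ∘ₗ dEven J r V W = 0 := by
  refine LinearMap.ext fun f => ?_
  let F : GrTensor J r V →ₗ[k] W := ∑ i : I, (vpart J W i).subtype ∘ₗ f i ∘ₗ vproj J _ i
  have hF1 : ∀ (i : I) (x : vpart J (GrTensor J r V) i), F x = f i x := by
    intro i x
    change (∑ i : I, (vpart J W i).subtype ∘ₗ f i ∘ₗ vproj J _ i) _ = _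
    rw [LinearMap.sum_apply, Finset.sum_eq_single i]
    · change ((f i (vproj J _ i x) : vpart J W i) : W) = _
      rw [vproj_coe]
    · intro j _ hj
      have : vproj J (GrTensor J r V) j x = 0 := by
        obtain ⟨_, y, rfl⟩ := x
        refine Subtype.ext ?_
        change rep J _ (vtx k j) (rep J _ (vtx k i) y) = 0
        rw [← Module.End.mul_apply, ← map_mul, vtx_mul_vtx_ne hj, map_zero, LinearMap.zero_apply]
      change ((f j (vproj J _ j x) : vpart J W j) : W) = _
      rw [this, map_zero]
      rfl
    · intro h
      exact absurd (Finset.mem_univ _) h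
  have hF2 : ∀ (i : I) (x : GrTensor J r V), rep J W (vtx k i) (F x) = f i (vproj J _ i x) := by
    intro i x
    change rep J W (vtx k i) ((∑ i : I, (vpart J W i).subtype ∘ₗ f i ∘ₗ vproj J _ i) x) = _
    rw [LinearMap.sum_apply, map_sum, Finset.sum_eq_single i]
    · change ((vproj J W i (f i (vproj J _ i x)) : vpart J W i) : W) = _
      rw [vproj_coe]
    · intro j _ hj
      change rep J W (vtx k i) ((f j (vproj J _ j x) : vpart J W j) : W) = 0
      obtain ⟨y, hy⟩ := (f j (vproj J _ j x)).2
      rw [← hy, ← Module.End.mul_apply, ← map_mul, vtx_mul_vtx_ne hj.symm, map_zero,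
        LinearMap.zero_apply]
    · intro h
      exact absurd (Finset.mem_univ _) h
  have hD : ∀ s : PathAlgebra k I, (dEven J r V W f).deriv s =
      F ∘ₗ rep J (GrTensor J r V) s - rep J W s ∘ₗ F := by
    intro s
    have H : (dEven J r V W f).deriv =
        (LinearMap.llcomp k (GrTensor J r V) (GrTensor J r V) W F).comp
            (rep J (GrTensor J r V)).toLinearMap -
          ((LinearMap.llcomp k (GrTensor J r V) W W).flip F).comp (rep J W).toLinearMap := by
      refine lin_ext fun i j p => ?_
      change (dEven J r V W f).deriv (ofPath k p) =
        F ∘ₗ rep J (GrTensor J r V) (ofPath k p) - rep J W (ofPath k p) ∘ₗ F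
      rw [OddCochain.deriv, deriv_ofPath]
      induction p with
      | nil =>
        refine LinearMap.ext fun x => ?_
        change (0 : W) = F (vproj J (GrTensor J r V) i x : GrTensor J r V) -
          rep J W (vtx k i) (F x)
        rw [hF1, hF2, sub_self]
      | @cons b c p α ih =>
        refine LinearMap.ext fun x => ?_
        rw [pathDeriv, ih, ofPath_cons, map_mul, map_mul]
        set y := rep J (GrTensor J r V) (ofPath k p) x with hy
        have h1 : (dEven J r V W f).ext α y =
            F (rep J (GrTensor J r V) (arr k α) y) - rep J W (arr k α) (F y) := by
          change ((f c (arrMap J _ α (vproj J _ b y)) : vpart J W c) : W) -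
            rep J W (arr k α) (f b (vproj J _ b y)) = _
          rw [← hF1, ← hF2, ← Module.End.mul_apply, ← map_mul, arr_mul_vtx]
          congr 2
          change rep J _ (arr k α) (rep J _ (vtx k b) y) = _
          rw [← Module.End.mul_apply, ← map_mul, arr_mul_vtx]
        change rep J W (arr k α) (F y - rep J W (ofPath k p) (F x)) +
          (dEven J r V W f).ext α y = F (rep J (GrTensor J r V) (arr k α) y) -
            rep J W (arr k α) (rep J W (ofPath k p) (F x))
        rw [h1, map_sub]
        abel
    exact congr($H s)
  have h0 : connecting (dEven J r V W f) = 0 := by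
    refine connecting_unique fun s x v => ?_
    rw [connecting_tmul, hD, rep_eq_zero J _ s.2, rep_eq_zero J _ s.2]
    simp
  funext i
  change vproj J W i ∘ₗ (connecting (dEven J r V W f)).restrictScalars k ∘ₗ _ = 0
  rw [h0]
  exact LinearMap.ext fun x => map_zero (vproj J W i)

/-- The connecting map sends `(A^{r+1} ⊗_A V)_i` to `W_i`. -/
theorem dOdd_apply_coe (g : OddCochain J r V W) (i : I)
    (x : vpart J (GrTensor J (r + 1) V) i) :
    (dOdd J r V W g i x : W) = connecting g (x : GrTensor J (r + 1) V) := by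
  have h : Ideal.Quotient.mk J (vtx k i) • (x : GrTensor J (r + 1) V) = x :=
    congrArg Subtype.val (vproj_coe J _ x)
  change Ideal.Quotient.mk J (vtx k i) • connecting g (x : GrTensor J (r + 1) V) = _
  rw [← map_smul, h]

theorem dEven_comp_dOdd : dEven J (r + 1) V W ∘ₗ dOdd J r V W = 0 := by
  refine LinearMap.ext fun g => ?_
  funext i j α
  refine LinearMap.ext fun x => Subtype.ext ?_
  change (dOdd J r V W g j (arrMap J _ α x) : W) -
    Ideal.Quotient.mk J (arr k α) • (dOdd J r V W g i x : W) = 0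
  rw [dOdd_apply_coe, dOdd_apply_coe, ← map_smul, sub_eq_zero]
  rfl

end Complex

section Cochain

open CategoryTheory

variable {k : Type u} [Field k] {I : Type w} [Quiver.{t + 1} I] [Fintype I]
variable (J : Ideal (PathAlgebra k I)) [J.IsTwoSided]
variable (V : Type v) [AddCommGroup V] [Module (PathAlgebra k I ⧸ J) V]
variable (W : Type v) [AddCommGroup W] [Module (PathAlgebra k I ⧸ J) W] [Module k W]
  [IsScalarTower k (PathAlgebra k I ⧸ J) W]

/-- `C^{2r+n}(V, W)`, by recursion on `n` in steps of two. -/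
def cochainObj : ℕ → ℕ → ModuleCat.{max u v w (t + 1)} k
  | r, 0 => ModuleCat.of k (EvenCochain J r V W)
  | r, 1 => ModuleCat.of k (OddCochain J r V W)
  | r, n + 2 => cochainObj (r + 1) n

/-- The differential `C^{2r+n}(V, W) → C^{2r+n+1}(V, W)`. -/
def cochainD : ∀ r n : ℕ, cochainObj J V W r n ⟶ cochainObj J V W r (n + 1)
  | r, 0 => ModuleCat.ofHom (dEven J r V W)
  | r, 1 => ModuleCat.ofHom (dOdd J r V W)
  | r, n + 2 => cochainD (r + 1) n

theorem cochainD_comp : ∀ r n : ℕ, cochainD J V W r n ≫ cochainD J V W r (n + 1) = 0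
  | r, 0 => ModuleCat.hom_ext (dOdd_comp_dEven J r V W)
  | r, 1 => ModuleCat.hom_ext (dEven_comp_dOdd J r V W)
  | r, n + 2 => cochainD_comp (r + 1) n

/-- The complex `C^•(V, W)` of `k`-vector spaces:
`C^0 → C^1 → C^2 → ⋯` with the differentials `dEven` and `dOdd` in turn. -/
def cochainComplex : CochainComplex (ModuleCat.{max u v w (t + 1)} k) ℕ :=
  CochainComplex.of (cochainObj J V W 0) (cochainD J V W 0) (cochainD_comp J V W 0)

end Cochain

end QuiverExt

end

/-! Put A = kQ/J and X_r = A^r ⊗_A V. In W, the cochains C^n(V, W) form a representable functor: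
C^n(V, W) = Hom_A(P_n, W) with P_{2r} = ⨁_i A e_i ⊗_k (X_r)_i and P_{2r+1} = ⨁_α A e_{h(α)} ⊗_k
(X_r)_{t(α)}, both projective. The differentials are natural in W, so by Yoneda they come from maps
P_{n+1} → P_n. It remains to see that ⋯ → P_1 → P_0 → V → 0 is exact, and this is tested by maps
into suitable modules.

(a) A cocycle in C^{2r} is a morphism of representations, that is, an A-linear map X_r → W. Hence
X_r is the cokernel of P_{2r+1} → P_{2r} (`exists_augmentation`).

(b) If g in C^{2r+1} is a cocycle, then D_g vanishes on J, so it twists the A-module structure of W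
⊕ X_r. In this extension of X_r by W the cochain g becomes a coboundary (`exists_dEven_eq`), which
gives exactness at P_{2r+1}.

(c) The map P_{2r+2} → P_{2r+1} is the projection P_{2r+2} → X_{r+1} of (a) followed by the
connecting map of the universal odd cochain. So exactness at P_{2r+2} needs only one g with
injective connecting map (`exists_connecting_injective`). The multiplication J × X_r → X_{r+1} is
balanced over kQ. Extend it linearly to M on kQ; the defect M(ab)x - M(a)(bx) depends on a modulo J
only, and as a function of b it is a derivation into Hom_k(X_r, Hom_k(A, X_{r+1})). Its connecting
map is the unit X_{r+1} → Hom_k(A, X_{r+1}), which is injective.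

The defect construction (`exists_derivation_of_balanced`) also yields (K2). Derivations of kQ that
kill the trivial paths are given freely by their values on arrows, so they extend along an injection
N → N'; hence so do balanced maps on J × N, in particular the canonical one to J ⊗ N. (K1) holds
because k is a field. -/

noncomputable section

namespace QuiverExt

/-! ### Ext from an explicit projective resolution -/

section ExtComputation

open CategoryTheory CategoryTheory.Abelian

universe u' w'

variable {k : Type u} [Field k] {A : Type w} [Ring A] [Algebra k A]

/-- An exact sequence `⋯ → P 1 → P 0 → V → 0` of modules with projective `P n`, as a projective
resolution. -/
def projectiveResolutionOfExact [Small.{v} A] (V : ModuleCat.{v} A) (P : ℕ → ModuleCat.{v} A)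
    (hP : ∀ n, Module.Projective A (P n)) (d : ∀ n, P (n + 1) →ₗ[A] P n) (ε : P 0 →ₗ[A] V)
    (hε : Function.Surjective ε) (h0 : Function.Exact (d 0) ε)
    (hd : ∀ n, Function.Exact (d (n + 1)) (d n)) : ProjectiveResolution V where
  complex := ChainComplex.of P (fun n => ModuleCat.ofHom (d n))
    fun n => ModuleCat.hom_ext (hd n).linearMap_comp_eq_zero
  projective n := (IsProjective.iff_projective (P n)).1 (hP n)
  π := (ChainComplex.toSingle₀Equiv _ _).symm ⟨ModuleCat.ofHom ε, by
    have h : ChainComplex.of.d P (fun n => ModuleCat.ofHom (d n)) (0 + 1) 0 = ModuleCat.ofHom (d 0) :=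
      ChainComplex.of_d P (fun n => ModuleCat.ofHom (d n)) 0
    change ChainComplex.of.d P (fun n => ModuleCat.ofHom (d n)) (0 + 1) 0 ≫ _ = 0
    rw [h]
    exact ModuleCat.hom_ext h0.linearMap_comp_eq_zero⟩
  quasiIso := ⟨fun n => by
    cases n with
    | zero =>
      -- In degree 0 the condition is that P 1 → P 0 → V is exact with surjective second map; in
      -- positive degrees the target is zero, so it is exactness of the complex.
      rw [ChainComplex.quasiIsoAt₀_iff, ShortComplex.quasiIso_iff_of_zeros']
      · have hS : (ShortComplex.mk (ModuleCat.ofHom (d 0)) (ModuleCat.ofHom ε)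
            (ModuleCat.hom_ext h0.linearMap_comp_eq_zero)).Exact :=
          (ShortComplex.moduleCat_exact_iff _).2 fun x hx => (h0 x).1 hx
        have hepi : Epi (ModuleCat.ofHom ε) := (ModuleCat.epi_iff_surjective _).2 hε
        dsimp
        refine (ShortComplex.exact_and_epi_g_iff_of_iso ?_).2 ⟨hS, hepi⟩
        exact ShortComplex.isoMk (Iso.refl _) (Iso.refl _) (Iso.refl _)
          ((Category.id_comp _).trans ((ChainComplex.of_d P (fun n => ModuleCat.ofHom (d n)) 0).symm.trans
            (Category.comp_id _).symm))
          ((Category.id_comp _).trans (Eq.trans (by rfl) (Category.comp_id _).symm))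
      all_goals rfl
    | succ n =>
      rw [quasiIsoAt_iff_exactAt']
      · rw [HomologicalComplex.exactAt_iff' _ (n + 1 + 1) (n + 1) n (by simp) (by simp)]
        rw [ShortComplex.moduleCat_exact_iff]
        simp only [HomologicalComplex.sc', HomologicalComplex.shortComplexFunctor',
          ChainComplex.of_d]
        exact fun x hx => (hd n x).1 hx
      · apply ChainComplex.exactAt_succ_single_obj⟩

theorem projectiveResolutionOfExact_d [Small.{v} A] (V : ModuleCat.{v} A)
    (P : ℕ → ModuleCat.{v} A)
    (hP : ∀ n, Module.Projective A (P n)) (d : ∀ n, P (n + 1) →ₗ[A] P n) (ε : P 0 →ₗ[A] V)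
    (hε : Function.Surjective ε) (h0 : Function.Exact (d 0) ε)
    (hd : ∀ n, Function.Exact (d (n + 1)) (d n)) (n : ℕ) :
    (projectiveResolutionOfExact V P hP d ε hε h0 hd).complex.d (n + 1) n =
      ModuleCat.ofHom (d n) :=
  ChainComplex.of_d P (fun n => ModuleCat.ofHom (d n)) n

variable (k) in
/-- Precomposition with an `A`-linear map, as a `k`-linear map. -/
def precompLin {P Q : Type*} [AddCommGroup P] [Module A P] [AddCommGroup Q] [Module A Q]
    (d : P →ₗ[A] Q) (W : Type*) [AddCommGroup W] [Module A W] [Module k W] [IsScalarTower k A W] :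
    (Q →ₗ[A] W) →ₗ[k] (P →ₗ[A] W) where
  toFun φ := φ ∘ₗ d
  map_add' _ _ := rfl
  map_smul' _ _ := rfl

/-- Two quotients of a module by the same submodule are isomorphic. -/
theorem nonempty_linearEquiv_of_surjective {Z M N : Type*} [AddCommGroup Z] [Module k Z]
    [AddCommGroup M] [Module k M] [AddCommGroup N] [Module k N] (a : Z →ₗ[k] M) (b : Z →ₗ[k] N)
    (ha : Function.Surjective a) (hb : Function.Surjective b)
    (h : LinearMap.ker a = LinearMap.ker b) : Nonempty (M ≃ₗ[k] N) :=
  ⟨(a.quotKerEquivOfSurjective ha).symm ≪≫ₗ Submodule.quotEquivOfEq _ _ h ≪≫ₗ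
    b.quotKerEquivOfSurjective hb⟩

/-- The homology of a cochain complex of vector spaces as a quotient of the cocycles. -/
theorem exists_cocycles_to_homology (K : CochainComplex (ModuleCat.{u'} k) ℕ) (p : ℕ) :
    ∃ b : ↥(LinearMap.ker (K.d p (p + 1)).hom) →ₗ[k] ↑(K.homology p), Function.Surjective b ∧
      ∀ z, b z = 0 ↔ ∃ y, (K.d ((ComplexShape.up ℕ).prev p) p).hom y = z := by
  let S := K.sc' ((ComplexShape.up ℕ).prev p) p (p + 1)
  let i : S.homology ≅ K.homology p := (K.homologyIsoSc' _ p (p + 1) rfl (by simp)).symm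
  let j : S.homology ≃ₗ[k] (LinearMap.ker S.g.hom ⧸ LinearMap.range S.moduleCatToCycles) :=
    S.moduleCatHomologyIso.toLinearEquiv
  let b0 : LinearMap.ker S.g.hom →ₗ[k] K.homology p :=
    (j.symm ≪≫ₗ i.toLinearEquiv).toLinearMap ∘ₗ (LinearMap.range S.moduleCatToCycles).mkQ
  have hb0 : Function.Surjective b0 := (j.symm ≪≫ₗ i.toLinearEquiv).surjective.comp
    (Submodule.mkQ_surjective (LinearMap.range S.moduleCatToCycles))
  refine ⟨b0, hb0, ?_⟩
  intro z
  change (j.symm ≪≫ₗ i.toLinearEquiv) (Submodule.mkQ _ z) = 0 ↔ _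
  rw [LinearEquiv.map_eq_zero_iff]
  refine (Submodule.Quotient.mk_eq_zero _).trans ?_
  constructor
  · rintro ⟨y, hy⟩
    exact ⟨y, congrArg Subtype.val hy⟩
  · rintro ⟨y, hy⟩
    exact ⟨y, Subtype.ext hy⟩

/-- Multiplication by a scalar on `Ext` agrees with that on representing cocycles. -/
theorem extMk_smul [Small.{v} A] {V W : ModuleCat.{v} A} (R : ProjectiveResolution V) {n : ℕ}
    (f : R.complex.X n ⟶ W) (m : ℕ) (hm : n + 1 = m) (hf : R.complex.d m n ≫ f = 0) (c : k) :
    c • R.extMk f m hm hf = R.extMk (c • f) m hm (by rw [Linear.comp_smul, hf, smul_zero]) := by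
  rw [Ext.smul_eq_comp_mk₀, R.extMk_comp_mk₀]
  simp

/-- `Ext` is the cohomology of any complex of vector spaces that is isomorphic to
`Hom_A(P, W)`, where `P` is a projective resolution. -/
theorem ext_equiv_homology [Small.{v} A] (V : ModuleCat.{v} A)
    (W : Type v) [AddCommGroup W] [Module A W] [Module k W] [IsScalarTower k A W]
    (P : ℕ → ModuleCat.{v} A)
    (hP : ∀ n, Module.Projective A (P n)) (d : ∀ n, P (n + 1) →ₗ[A] P n) (ε : P 0 →ₗ[A] V)
    (hε : Function.Surjective ε) (h0 : Function.Exact (d 0) ε)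
    (hd : ∀ n, Function.Exact (d (n + 1)) (d n))
    (K : CochainComplex (ModuleCat.{u'} k) ℕ) (e : ∀ n, (P n →ₗ[A] W) ≃ₗ[k] K.X n)
    (he : ∀ n φ, (K.d n (n + 1)).hom (e n φ) = e (n + 1) (φ ∘ₗ d n)) (p : ℕ) :
    Nonempty (Ext V (ModuleCat.of A W) p ≃ₗ[k] K.homology p) := by
  obtain ⟨b, hb, hb0⟩ := exists_cocycles_to_homology K p
  -- The cocycles in Hom_A(P p, W) map onto both sides; the two kernels are then compared.
  let Z : Submodule k (P p →ₗ[A] W) := LinearMap.ker (precompLin k (d p) W)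
  have hZ : ∀ φ : P p →ₗ[A] W, φ ∈ Z ↔ e p φ ∈ LinearMap.ker (K.d p (p + 1)).hom := by
    intro φ
    rw [LinearMap.mem_ker, LinearMap.mem_ker, he, LinearEquiv.map_eq_zero_iff]
    rfl
  let eZ : Z →ₗ[k] LinearMap.ker (K.d p (p + 1)).hom :=
    (e p).toLinearMap.restrict fun φ hφ => (hZ φ).1 hφ
  have heZ : Function.Surjective eZ := fun z =>
    ⟨⟨(e p).symm z, (hZ _).2 (by rw [LinearEquiv.apply_symm_apply]; exact z.2)⟩,
      Subtype.ext ((e p).apply_symm_apply z)⟩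
  -- Degree 0 is separate: it has no coboundaries, and the criterion for a class in Ext to vanish
  -- needs a preceding term of the resolution.
  cases p with
  | zero =>
    let _ : Module k (V ⟶ ModuleCat.of A W) := Linear.homModule V (ModuleCat.of A W)
    let a : (V ⟶ ModuleCat.of A W) →ₗ[k] Z :=
      { toFun := fun f => ⟨f.hom ∘ₗ ε, by
          change (f.hom ∘ₗ ε) ∘ₗ d 0 = 0
          rw [LinearMap.comp_assoc, h0.linearMap_comp_eq_zero, LinearMap.comp_zero]⟩
        map_add' := fun _ _ => rfl
        map_smul' := fun c f => Subtype.ext (LinearMap.ext fun x => by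
          -- Morphisms in `ModuleCat` carry the scalars that come through `algebraMap k A`, whereas
          -- `W` has its own k-structure; the scalar tower identifies them.
          change algebraMap k A c • f.hom (ε x) = c • f.hom (ε x)
          rw [algebraMap_smul]) }
    have ha : Function.Bijective a := by
      constructor
      · intro f g h
        refine ModuleCat.hom_ext (LinearMap.ext fun x => ?_)
        obtain ⟨y, rfl⟩ := hε x
        exact congr($(congrArg Subtype.val h) y)
      · rintro ⟨φ, hφ⟩
        -- V is the cokernel of `d 0`, so a map on P 0 that kills the image of `d 0` descends to V.
        have hφ' : LinearMap.ker ε ≤ LinearMap.ker φ := by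
          intro x hx
          obtain ⟨y, rfl⟩ := (h0 x).1 hx
          exact congr($(show φ ∘ₗ d 0 = 0 from hφ) y)
        refine ⟨ModuleCat.ofHom ((LinearMap.ker ε).liftQ φ hφ' ∘ₗ
          (ε.quotKerEquivOfSurjective hε).symm.toLinearMap), Subtype.ext (LinearMap.ext fun x => ?_)⟩
        change (LinearMap.ker ε).liftQ φ hφ' ((ε.quotKerEquivOfSurjective hε).symm (ε x)) = φ x
        have : (ε.quotKerEquivOfSurjective hε).symm (ε x) = (LinearMap.ker ε).mkQ x := by
          rw [LinearEquiv.symm_apply_eq]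
          rfl
        rw [this]
        rfl
    have hb' : Function.Bijective (b ∘ₗ eZ) := by
      refine ⟨?_, hb.comp heZ⟩
      rw [← LinearMap.ker_eq_bot, LinearMap.ker_eq_bot']
      intro z hz
      obtain ⟨y, hy⟩ := (hb0 _).1 hz
      -- By convention `prev 0 = 0`, and the map from degree 0 to itself is zero, so only the zero
      -- cocycle is a coboundary.
      have hs : K.d ((ComplexShape.up ℕ).prev 0) 0 = 0 := K.shape _ _ (by simp)
      rw [hs] at hy
      exact Subtype.ext ((e 0).map_eq_zero_iff.1 hy.symm)
    exact ⟨Ext.linearEquiv₀ ≪≫ₗ LinearEquiv.ofBijective a ha ≪≫ₗ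
      LinearEquiv.ofBijective (b ∘ₗ eZ) hb'⟩
  | succ p =>
    let R := projectiveResolutionOfExact V P hP d ε hε h0 hd
    have hR : ∀ n, R.complex.d (n + 1) n = ModuleCat.ofHom (d n) :=
      projectiveResolutionOfExact_d V P hP d ε hε h0 hd
    have hcond : ∀ φ : P (p + 1) →ₗ[A] W, φ ∈ Z → R.complex.d (p + 1 + 1) (p + 1) ≫
        (ModuleCat.ofHom φ : R.complex.X (p + 1) ⟶ ModuleCat.of A W) = 0 := by
      intro φ hφ
      rw [hR]
      exact ModuleCat.hom_ext hφ
    let a : Z →ₗ[k] Ext V (ModuleCat.of A W) (p + 1) :=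
      { toFun := fun φ => R.extMk (ModuleCat.ofHom φ.1) (p + 1 + 1) rfl (hcond φ.1 φ.2)
        map_add' := fun φ ψ => (R.add_extMk (ModuleCat.ofHom φ.1) (ModuleCat.ofHom ψ.1) (p + 1 + 1) rfl (hcond φ.1 φ.2) (hcond ψ.1 ψ.2)).symm
        map_smul' := fun c φ => by
          refine Eq.trans ?_ (extMk_smul R (ModuleCat.ofHom φ.1) (p + 1 + 1) rfl
            (hcond φ.1 φ.2) c).symm
          congr 1
          refine ModuleCat.hom_ext (LinearMap.ext fun x => ?_)
          change c • φ.1 x = algebraMap k A c • φ.1 x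
          rw [algebraMap_smul] }
    have ha : Function.Surjective a := by
      intro α
      obtain ⟨f, hf, rfl⟩ := R.extMk_surjective α (p + 1 + 1) rfl
      refine ⟨⟨f.hom, ?_⟩, rfl⟩
      rw [hR] at hf
      exact congrArg ModuleCat.Hom.hom hf
    refine nonempty_linearEquiv_of_surjective a (b ∘ₗ eZ) ha (hb.comp heZ) ?_
    ext φ
    rw [LinearMap.mem_ker, LinearMap.mem_ker, LinearMap.comp_apply, hb0]
    have h1 : a φ = 0 ↔ ∃ ψ : P p →ₗ[A] W, ψ ∘ₗ d p = φ.1 := by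
      refine (R.extMk_eq_zero_iff (ModuleCat.ofHom φ.1) (p + 1 + 1) rfl
        (hcond φ.1 φ.2) p rfl).trans ?_
      rw [hR]
      constructor
      · rintro ⟨g, hg⟩
        exact ⟨g.hom, congrArg ModuleCat.Hom.hom hg⟩
      · rintro ⟨ψ, hψ⟩
        exact ⟨ModuleCat.ofHom ψ, ModuleCat.hom_ext hψ⟩
    have h2 : (ComplexShape.up ℕ).prev (p + 1) = p := by simp
    rw [h1, h2]
    constructor
    · rintro ⟨ψ, hψ⟩
      refine ⟨e p ψ, ?_⟩
      rw [he, hψ]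
      rfl
    · rintro ⟨y, hy⟩
      refine ⟨(e p).symm y, (e (p + 1)).injective ?_⟩
      rw [← he, LinearEquiv.apply_symm_apply]
      exact hy

end ExtComputation

/-! ### Direct sums of left ideals generated by idempotents -/

section Cell

variable {A : Type*} [Ring A] {B : Type*} (c : B → A)

/-- The endomorphism of the free module on `B` that multiplies the coordinate at `b` by `c b` on
the right. -/
def cellProj : (B →₀ A) →ₗ[A] (B →₀ A) :=
  Finsupp.linearCombination A fun b => Finsupp.single b (c b)

theorem cellProj_single (b : B) (a : A) :
    cellProj c (Finsupp.single b a) = Finsupp.single b (a * c b) := by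
  rw [cellProj, Finsupp.linearCombination_single, Finsupp.smul_single, smul_eq_mul]

/-- The direct sum `⨁ b, A (c b)` of left ideals. -/
def Cell : Submodule A (B →₀ A) := LinearMap.range (cellProj c)

/-- The generator of the summand `A (c b)`. -/
def Cell.gen (b : B) : Cell c :=
  ⟨Finsupp.single b (c b), Finsupp.single b 1, by rw [cellProj_single, one_mul]⟩

theorem Cell.smul_gen (hc : ∀ b, c b * c b = c b) (b : B) : c b • Cell.gen c b = Cell.gen c b :=
  Subtype.ext (by
    change c b • Finsupp.single b (c b) = Finsupp.single b (c b)
    rw [Finsupp.smul_single, smul_eq_mul, hc])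

theorem cellProj_of_mem (hc : ∀ b, c b * c b = c b) {x : B →₀ A} (hx : x ∈ Cell c) :
    cellProj c x = x := by
  obtain ⟨y, rfl⟩ := hx
  have H : cellProj c ∘ₗ cellProj c = cellProj c := by
    refine Finsupp.lhom_ext fun b a => ?_
    rw [LinearMap.comp_apply, cellProj_single, cellProj_single, mul_assoc, hc]
  exact congr($H y)

/-- For idempotent c b, `cellProj` is a projection of the free module onto the cell, which is thus a
direct summand. -/
theorem Cell.projective (hc : ∀ b, c b * c b = c b) : Module.Projective A (Cell c) :=
  Module.Projective.of_split (Cell c).subtype (cellProj c).rangeRestrict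
    (LinearMap.ext fun x => Subtype.ext (cellProj_of_mem c hc x.2))

theorem Cell.exists_eq_sum (x : Cell c) :
    ∃ y : B →₀ A, x = Finsupp.linearCombination A (Cell.gen c) y := by
  obtain ⟨_, y, rfl⟩ := x
  refine ⟨y, Subtype.ext ?_⟩
  have H : (Cell c).subtype ∘ₗ Finsupp.linearCombination A (Cell.gen c) = cellProj c := by
    refine Finsupp.lhom_ext fun b a => ?_
    simp [cellProj, Cell.gen]
  exact congr($H y).symm

variable {c}

theorem Cell.hom_ext {W : Type*} [AddCommGroup W] [Module A W] {φ ψ : Cell c →ₗ[A] W}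
    (h : ∀ b, φ (Cell.gen c b) = ψ (Cell.gen c b)) : φ = ψ := by
  have H : φ ∘ₗ Finsupp.linearCombination A (Cell.gen c) =
      ψ ∘ₗ Finsupp.linearCombination A (Cell.gen c) := by
    refine Finsupp.lhom_ext fun b a => ?_
    simp [h]
  refine LinearMap.ext fun x => ?_
  obtain ⟨y, rfl⟩ := Cell.exists_eq_sum c x
  exact congr($H y)

/-- The map on the free module with b ↦ w b restricts to the cell; the generator c b goes to c b • w
b, whence the condition on w. -/
theorem Cell.exists_hom {W : Type*} [AddCommGroup W] [Module A W] (w : B → W)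
    (hw : ∀ b, c b • w b = w b) : ∃ φ : Cell c →ₗ[A] W, ∀ b, φ (Cell.gen c b) = w b :=
  ⟨Finsupp.linearCombination A w ∘ₗ (Cell c).subtype, fun b => by simp [Cell.gen, hw]⟩

end Cell

/-! ### Modules representing families of linear maps into vertex components -/

section Universal

variable {k : Type u} [Field k] {I : Type w} [Quiver.{t + 1} I] [Fintype I]
variable (J : Ideal (PathAlgebra k I)) [J.IsTwoSided]

section VMap

variable {X X' X'' : Type*} [AddCommGroup X] [Module (PathAlgebra k I ⧸ J) X] [Module k X]
  [IsScalarTower k (PathAlgebra k I ⧸ J) X]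
  [AddCommGroup X'] [Module (PathAlgebra k I ⧸ J) X'] [Module k X']
  [IsScalarTower k (PathAlgebra k I ⧸ J) X']

variable {J} in
theorem mem_vpart {i : I} {x : X} :
    x ∈ vpart J X i ↔ Ideal.Quotient.mk J (vtx k i) • x = x := by
  constructor
  · intro h
    exact congrArg Subtype.val (vproj_coe J X ⟨x, h⟩)
  · intro h
    exact ⟨x, h⟩

theorem mk_vtx_mul_self (i : I) : Ideal.Quotient.mk J (vtx k i) * Ideal.Quotient.mk J (vtx k i) =
    Ideal.Quotient.mk J (vtx k i) := by
  rw [← map_mul, vtx_mul_vtx]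

theorem sum_vtx_smul (x : X) : ∑ i : I, Ideal.Quotient.mk J (vtx k i) • x = x := by
  rw [← Finset.sum_smul, ← map_sum]
  exact one_smul (PathAlgebra k I ⧸ J) x

/-- The map `X_i → X'_i` given by an `A`-linear map `X → X'`. -/
def vmap (φ : X →ₗ[PathAlgebra k I ⧸ J] X') (i : I) : vpart J X i →ₗ[k] vpart J X' i :=
  (φ.restrictScalars k).restrict fun x hx => by
    rw [mem_vpart] at hx ⊢
    change _ • φ x = φ x
    rw [← map_smul, hx]

theorem vmap_coe (φ : X →ₗ[PathAlgebra k I ⧸ J] X') (i : I) (x : vpart J X i) :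
    (vmap J φ i x : X') = φ x := rfl

end VMap

section GProj

variable {T : Type*} (h : T → I) (Y : T → Type*) [∀ s, AddCommGroup (Y s)] [∀ s, Module k (Y s)]

/-- Bases of all the vector spaces `Y s`. -/
abbrev BasisIndex := Σ s : T, Module.Basis.ofVectorSpaceIndex k (Y s)

/-- The `A`-module `⨁ s, A e_{h s} ⊗ Y s`. -/
abbrev VCell := Cell (B := BasisIndex (k := k) Y) fun b => Ideal.Quotient.mk J (vtx k (h b.1))

variable [Small.{v} (VCell J h Y)]

/-- The `A`-module `⨁ s, A e_{h s} ⊗ Y s`, in a given universe. -/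
def VProj : Type v := Shrink.{v} (VCell J h Y)

instance : AddCommGroup (VProj J h Y) := inferInstanceAs (AddCommGroup (Shrink.{v} (VCell J h Y)))

instance : Module (PathAlgebra k I ⧸ J) (VProj J h Y) :=
  inferInstanceAs (Module (PathAlgebra k I ⧸ J) (Shrink.{v} (VCell J h Y)))

instance : Module k (VProj J h Y) := Module.compHom _ (algebraMap k (PathAlgebra k I ⧸ J))

instance : IsScalarTower k (PathAlgebra k I ⧸ J) (VProj J h Y) :=
  ⟨fun c a x => by
    rw [Algebra.smul_def, mul_smul]
    rfl⟩

/-- The change of universe. -/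
def VProj.equiv : VProj J h Y ≃ₗ[PathAlgebra k I ⧸ J] VCell J h Y :=
  Shrink.linearEquiv (PathAlgebra k I ⧸ J) (VCell J h Y)

theorem VProj.projective : Module.Projective (PathAlgebra k I ⧸ J) (VProj J h Y) :=
  have := Cell.projective (fun b : BasisIndex (k := k) Y => Ideal.Quotient.mk J (vtx k (h b.1)))
    fun b => mk_vtx_mul_self J (h b.1)
  Module.Projective.of_equiv (VProj.equiv J h Y).symm

/-- The universal family of maps `Y s → P_{h s}`. -/
def VProj.univ (s : T) : Y s →ₗ[k] vpart J (VProj J h Y) (h s) :=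
  (Module.Basis.ofVectorSpace k (Y s)).constr k fun b =>
    ⟨(VProj.equiv J h Y).symm (Cell.gen _ ⟨s, b⟩), mem_vpart.2 (by
      rw [← map_smul]
      exact congrArg _ (Cell.smul_gen
        (fun b : BasisIndex (k := k) Y => Ideal.Quotient.mk J (vtx k (h b.1)))
        (fun b => mk_vtx_mul_self J (h b.1)) ⟨s, b⟩))⟩

theorem VProj.univ_basis (s : T) (b : Module.Basis.ofVectorSpaceIndex k (Y s)) :
    (VProj.univ J h Y s (Module.Basis.ofVectorSpace k (Y s) b) : VProj J h Y) =
      (VProj.equiv J h Y).symm (Cell.gen _ ⟨s, b⟩) := by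
  rw [VProj.univ, Module.Basis.constr_basis]

variable {W : Type*} [AddCommGroup W] [Module (PathAlgebra k I ⧸ J) W] [Module k W]
  [IsScalarTower k (PathAlgebra k I ⧸ J) W]

variable {h Y} in
-- Uniqueness half of the universal property: the images of basis vectors of the Y s are the
-- generators of the cell.
theorem VProj.hom_ext {φ ψ : VProj J h Y →ₗ[PathAlgebra k I ⧸ J] W}
    (H : ∀ s, vmap J φ (h s) ∘ₗ VProj.univ J h Y s = vmap J ψ (h s) ∘ₗ VProj.univ J h Y s) :
    φ = ψ := by
  have H' : φ ∘ₗ (VProj.equiv J h Y).symm.toLinearMap =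
      ψ ∘ₗ (VProj.equiv J h Y).symm.toLinearMap := by
    refine Cell.hom_ext fun b => ?_
    have := congrArg Subtype.val (congr($(H b.1) (Module.Basis.ofVectorSpace k (Y b.1) b.2)))
    simp only [LinearMap.comp_apply, vmap_coe, VProj.univ_basis] at this
    exact this
  refine LinearMap.ext fun x => ?_
  have := congr($H' (VProj.equiv J h Y x))
  simpa using this

/-- Existence half: a linear map out of Y s is a choice of images of basis vectors, and lying in the
component at h s is exactly the condition of `Cell.exists_hom`. -/
theorem VProj.exists_hom (g : ∀ s, Y s →ₗ[k] vpart J W (h s)) :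
    ∃ φ : VProj J h Y →ₗ[PathAlgebra k I ⧸ J] W,
      ∀ s, vmap J φ (h s) ∘ₗ VProj.univ J h Y s = g s := by
  obtain ⟨φ, hφ⟩ := Cell.exists_hom (W := W)
    (c := fun b : BasisIndex (k := k) Y => Ideal.Quotient.mk J (vtx k (h b.1)))
    (fun b => g b.1 (Module.Basis.ofVectorSpace k (Y b.1) b.2))
    fun b => mem_vpart.1 (g b.1 _).2
  refine ⟨φ ∘ₗ (VProj.equiv J h Y).toLinearMap, fun s => ?_⟩
  refine (Module.Basis.ofVectorSpace k (Y s)).ext fun b => Subtype.ext ?_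
  rw [LinearMap.comp_apply, vmap_coe, VProj.univ_basis, LinearMap.comp_apply]
  refine Eq.trans (congrArg φ ?_) (hφ ⟨s, b⟩)
  exact (VProj.equiv J h Y).apply_symm_apply _

end GProj

end Universal

theorem isScalarTower_shrink (k A M : Type*) [Field k] [Ring A] [Algebra k A] [AddCommGroup M]
    [Module k M] [Module A M] [IsScalarTower k A M] [Small.{v} M] :
    IsScalarTower k A (Shrink.{v} M) :=
  ⟨fun c a z => (Shrink.linearEquiv A M).injective (by
    change _ = Shrink.linearEquiv k M (c • a • z)
    rw [map_smul, smul_assoc, map_smul (Shrink.linearEquiv k M)]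
    exact congrArg _ (map_smul (Shrink.linearEquiv A M) a z).symm)⟩

/-! ### Extensions of modules defined by derivations -/

section TwistExt

/-- The space of an extension of `X` by `W`. -/
def TwistExt (W X : Type*) := W × X

variable (W X : Type*) [AddCommGroup W] [AddCommGroup X]

instance : AddCommGroup (TwistExt W X) := inferInstanceAs (AddCommGroup (W × X))

instance (k : Type*) [Field k] [Module k W] [Module k X] : Module k (TwistExt W X) :=
  inferInstanceAs (Module k (W × X))

instance [Small.{v} W] [Small.{v} X] : Small.{v} (TwistExt W X) :=
  inferInstanceAs (Small.{v} (W × X))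

end TwistExt

section Extension

variable {k : Type u} [Field k] {I : Type w} [Quiver.{t + 1} I] [Fintype I]
variable {J : Ideal (PathAlgebra k I)} [J.IsTwoSided]

section General

variable {X : Type*} [AddCommGroup X] [Module (PathAlgebra k I ⧸ J) X] [Module k X]
  [IsScalarTower k (PathAlgebra k I ⧸ J) X]
  {W : Type*} [AddCommGroup W] [Module (PathAlgebra k I ⧸ J) W] [Module k W]
  [IsScalarTower k (PathAlgebra k I ⧸ J) W]

/-- A linear map of `A`-modules that commutes with the paths is `A`-linear. -/
theorem map_mk_smul_of_path {F : X →ₗ[k] W}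
    (h1 : ∀ i x, F (Ideal.Quotient.mk J (vtx k i) • x) = Ideal.Quotient.mk J (vtx k i) • F x)
    (h2 : ∀ ⦃i j : I⦄ (α : i ⟶ j) x,
      F (Ideal.Quotient.mk J (arr k α) • x) = Ideal.Quotient.mk J (arr k α) • F x)
    (a : PathAlgebra k I) (x : X) :
    F (Ideal.Quotient.mk J a • x) = Ideal.Quotient.mk J a • F x := by
  have H : (LinearMap.llcomp k X X W F).comp (rep J X).toLinearMap =
      ((LinearMap.llcomp k X W W).flip F).comp (rep J W).toLinearMap := by
    refine lin_ext fun i j p => LinearMap.ext fun x => ?_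
    change F (Ideal.Quotient.mk J (ofPath k p) • x) = Ideal.Quotient.mk J (ofPath k p) • F x
    induction p with
    | nil => exact h1 i x
    | cons p α ih => rw [ofPath_cons, map_mul, mul_smul, mul_smul, h2, ih]
  exact congr($H a x)

/-- A morphism of representations of the quiver is a morphism of `A`-modules. -/
theorem exists_hom_of_comm (f : ∀ i, vpart J X i →ₗ[k] vpart J W i)
    (hf : ∀ ⦃i j : I⦄ (α : i ⟶ j), f j ∘ₗ arrMap J X α = arrMap J W α ∘ₗ f i) :
    ∃ F : X →ₗ[PathAlgebra k I ⧸ J] W, ∀ i, vmap J F i = f i := by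
  let F : X →ₗ[k] W := ∑ i : I, (vpart J W i).subtype ∘ₗ f i ∘ₗ vproj J X i
  have hF : ∀ x, F x = ∑ i : I, (f i (vproj J X i x) : W) := fun x => by
    rw [LinearMap.sum_apply]
    rfl
  have hne : ∀ {i j : I}, i ≠ j → Ideal.Quotient.mk J (vtx k i) * Ideal.Quotient.mk J (vtx k j) = 0 := by
    intro i j hij
    rw [← map_mul, vtx_mul_vtx_ne hij, map_zero]
  have hF1 : ∀ (i : I) (x : vpart J X i), F x = f i x := by
    intro i x
    rw [hF, Finset.sum_eq_single i]
    · rw [vproj_coe]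
    · intro j _ hj
      have : vproj J X j x = 0 := by
        refine Subtype.ext ?_
        change Ideal.Quotient.mk J (vtx k j) • (x : X) = 0
        rw [← mem_vpart.1 x.2, ← mul_smul, hne hj, zero_smul]
      rw [this, map_zero]
      rfl
    · intro h
      exact absurd (Finset.mem_univ _) h
  have hF2 : ∀ (i : I) (x : X), Ideal.Quotient.mk J (vtx k i) • F x = f i (vproj J X i x) := by
    intro i x
    rw [hF, Finset.smul_sum, Finset.sum_eq_single i]
    · exact mem_vpart.1 (f i (vproj J X i x)).2
    · intro j _ hj
      rw [← mem_vpart.1 (f j (vproj J X j x)).2, ← mul_smul, hne hj.symm, zero_smul]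
    · intro h
      exact absurd (Finset.mem_univ _) h
  have hlin := map_mk_smul_of_path (F := F) (J := J)
    (fun i x => (hF1 i (vproj J X i x)).trans (hF2 i x).symm)
    (fun i j α x => by
      have e1 : Ideal.Quotient.mk J (arr k α) • x = (arrMap J X α (vproj J X i x) : X) := by
        change _ = Ideal.Quotient.mk J (arr k α) • Ideal.Quotient.mk J (vtx k i) • x
        rw [← mul_smul, ← map_mul, arr_mul_vtx]
      have e2 : Ideal.Quotient.mk J (arr k α) • F x =
          Ideal.Quotient.mk J (arr k α) • Ideal.Quotient.mk J (vtx k i) • F x := by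
        rw [← mul_smul, ← map_mul, arr_mul_vtx]
      rw [e1, hF1, e2, hF2]
      exact congrArg Subtype.val (congr($(hf α) (vproj J X i x))))
  refine ⟨{ F with
    map_smul' := fun a x => by
      obtain ⟨a, rfl⟩ := Ideal.Quotient.mk_surjective a
      exact hlin a x }, fun i => LinearMap.ext fun x => Subtype.ext (hF1 i x)⟩

/-- A derivation on `A` with values in `Hom_k(X, W)` becomes inner in an extension of `X` by
`W`. -/
theorem exists_inner [Small.{v} W] [Small.{v} X] (D : PathAlgebra k I →ₗ[k] (X →ₗ[k] W))
    (hD : ∀ a b, D (a * b) = rep J W a ∘ₗ D b + D a ∘ₗ rep J X b)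
    (hJ : ∀ s ∈ J, D s = 0) :
    ∃ (E : Type v) (_ : AddCommGroup E) (_ : Module (PathAlgebra k I ⧸ J) E) (_ : Module k E)
      (_ : IsScalarTower k (PathAlgebra k I ⧸ J) E) (φ : W →ₗ[PathAlgebra k I ⧸ J] E)
      (f : X →ₗ[k] E), Function.Injective φ ∧ ∀ (a : PathAlgebra k I) (x : X),
        f (Ideal.Quotient.mk J a • x) - Ideal.Quotient.mk J a • f x = φ (D a x) := by
  have hD1 : D 1 = 0 := by
    have := hD 1 1
    rw [mul_one, map_one (rep J W), map_one (rep J X), Module.End.one_eq_id, Module.End.one_eq_id, LinearMap.id_comp,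
      LinearMap.comp_id] at this
    simpa using this
  -- The twisted action a(w, x) = (aw + D(a)x, ax). The Leibniz rule makes it multiplicative, and
  -- the vanishing of D on J lets it descend to A.
  let θ : PathAlgebra k I → Module.End k (TwistExt W X) := fun a =>
    ((rep J W a).coprod (D a)).prod (rep J X a ∘ₗ LinearMap.snd k W X)
  have hθ : ∀ a (z : TwistExt W X), θ a z = (rep J W a z.1 + D a z.2, rep J X a z.2) :=
    fun a z => rfl
  let Θ : PathAlgebra k I →ₐ[k] Module.End k (TwistExt W X) := AlgHom.ofLinearMap
    { toFun := θ
      map_add' := fun a b => LinearMap.ext fun z => by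
        rw [LinearMap.add_apply, hθ, hθ, hθ, map_add, map_add, map_add]
        refine Prod.ext ?_ rfl
        change _ + _ = (_ + _) + (_ + _)
        simp only [LinearMap.add_apply]
        abel
      map_smul' := fun c a => LinearMap.ext fun z => by
        rw [RingHom.id_apply, LinearMap.smul_apply, hθ, hθ, map_smul, map_smul, map_smul]
        refine Prod.ext ?_ rfl
        change _ + _ = c • (_ + _)
        rw [smul_add]
        rfl }
    (LinearMap.ext fun z => by
      change θ 1 z = z
      rw [hθ, map_one (rep J W), map_one (rep J X), hD1]
      exact Prod.ext (add_zero _) rfl)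
    (fun a b => LinearMap.ext fun z => by
      change θ (a * b) z = θ a (θ b z)
      rw [hθ, hθ, hθ, hD, map_mul, map_mul]
      refine Prod.ext ?_ rfl
      change rep J W a (rep J W b z.1) + (rep J W a (D b z.2) + D a (rep J X b z.2)) =
        rep J W a (rep J W b z.1 + D b z.2) + D a (rep J X b z.2)
      rw [map_add, add_assoc])
  have hΘ : ∀ s ∈ J, Θ.toRingHom s = 0 := fun s hs => LinearMap.ext fun z => by
    change θ s z = 0
    rw [hθ, rep_eq_zero J W hs, rep_eq_zero J X hs, hJ s hs]
    exact Prod.ext (add_zero _) rfl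
  let _ : Module (PathAlgebra k I ⧸ J) (TwistExt W X) :=
    Module.compHom _ (Ideal.Quotient.lift J Θ.toRingHom hΘ)
  have hsmul : ∀ (a : PathAlgebra k I) (z : TwistExt W X), Ideal.Quotient.mk J a • z = θ a z :=
    fun a z => rfl
  have hst : IsScalarTower k (PathAlgebra k I ⧸ J) (TwistExt W X) := ⟨fun c a z => by
    obtain ⟨a, rfl⟩ := Ideal.Quotient.mk_surjective a
    change Θ (c • a) z = c • Θ a z
    rw [map_smul]
    rfl⟩
  let e : Shrink.{v} (TwistExt W X) ≃ₗ[PathAlgebra k I ⧸ J] TwistExt W X :=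
    Shrink.linearEquiv (PathAlgebra k I ⧸ J) (TwistExt W X)
  let ek : Shrink.{v} (TwistExt W X) ≃ₗ[k] TwistExt W X := Shrink.linearEquiv k (TwistExt W X)
  let φ0 : W →ₗ[PathAlgebra k I ⧸ J] TwistExt W X :=
    { toFun := fun x => (x, 0)
      map_add' := fun x y => Prod.ext rfl (add_zero _).symm
      map_smul' := fun a x => by
        obtain ⟨a, rfl⟩ := Ideal.Quotient.mk_surjective a
        change ((rep J W a x, 0) : W × X) = (rep J W a x + D a 0, rep J X a 0)
        rw [map_zero, map_zero, add_zero] }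
  -- The sign is forced: for x ↦ (0, -x) the difference f(ax) - a f(x) is (D(a)x, 0), and without it
  -- the result would be (-D(a)x, 0).
  let f0 : X →ₗ[k] TwistExt W X := -LinearMap.inr k W X
  refine ⟨Shrink.{v} (TwistExt W X), inferInstance, inferInstance, inferInstance,
    isScalarTower_shrink k _ _,
    e.symm.toLinearMap ∘ₗ φ0, ek.symm.toLinearMap ∘ₗ f0,
    e.symm.injective.comp fun x y hxy => congrArg Prod.fst hxy, fun a x => ?_⟩
  change e.symm (f0 (Ideal.Quotient.mk J a • x)) - Ideal.Quotient.mk J a • e.symm (f0 x) =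
    e.symm (φ0 (D a x))
  rw [← map_smul, ← map_sub]
  congr 1
  rw [hsmul, hθ]
  change -((0 : W), Ideal.Quotient.mk J a • x) - (rep J W a (-0) + D a (-x), rep J X a (-x)) =
    (D a x, 0)
  rw [neg_zero, map_zero, zero_add, map_neg, map_neg]
  refine Prod.ext ?_ ?_
  · change -0 - -D a x = D a x
    simp
  · change -(rep J X a x) - -(rep J X a x) = 0
    simp

end General

variable {r : ℕ} {V : Type v} [AddCommGroup V] [Module (PathAlgebra k I ⧸ J) V]
  {W : Type v} [AddCommGroup W] [Module (PathAlgebra k I ⧸ J) W] [Module k W]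
  [IsScalarTower k (PathAlgebra k I ⧸ J) W]

theorem OddCochain.ext_rep (g : OddCochain J r V W) ⦃i j : I⦄ (α : i ⟶ j) :
    g.ext α ∘ₗ rep J (GrTensor J r V) (vtx k i) = g.ext α := by
  refine LinearMap.ext fun x => ?_
  change ((g i j α (vproj J _ i (vproj J _ i x : GrTensor J r V)) : vpart J W j) : W) = _
  rw [vproj_coe]
  rfl

theorem OddCochain.deriv_mul (g : OddCochain J r V W) (a b : PathAlgebra k I) :
    g.deriv (a * b) = rep J W a ∘ₗ g.deriv b + g.deriv a ∘ₗ rep J _ b :=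
  QuiverExt.deriv_mul _ _ _ g.ext_rep g.rep_ext a b

theorem OddCochain.deriv_arr (g : OddCochain J r V W) ⦃i j : I⦄ (α : i ⟶ j) :
    g.deriv (arr k α) = g.ext α := by
  refine (deriv_ofPath _ _ _ α.toPath).trans ?_
  change rep J W (arr k α) ∘ₗ 0 + g.ext α ∘ₗ rep J _ (vtx k i) = _
  rw [LinearMap.comp_zero, zero_add, g.ext_rep]

/-- On generators, D_g(s)([x] ⊗ v) is the value of the connecting map at [sx] ⊗ v. -/
theorem OddCochain.deriv_eq_zero (g : OddCochain J r V W) (hg : connecting g = 0)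
    (s : PathAlgebra k I) (hs : s ∈ J) : g.deriv s = 0 := by
  refine LinearMap.ext fun z => ?_
  refine GrTensor.induction J r (p := fun z => g.deriv s z = 0) (map_zero _) ?_ ?_ z
  · intro x y hx hy
    rw [map_add, hx, hy, add_zero]
  · intro x y
    rw [← connecting_tmul g ⟨s, hs⟩ x y, hg]
    rfl

/-- An odd cochain with trivial connecting map becomes a coboundary after enlarging `W`. -/
theorem exists_dEven_eq [Small.{v} (GrTensor J r V)] (g : OddCochain J r V W)
    (hg : connecting g = 0) :
    ∃ (E : Type v) (_ : AddCommGroup E) (_ : Module (PathAlgebra k I ⧸ J) E) (_ : Module k E)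
      (_ : IsScalarTower k (PathAlgebra k I ⧸ J) E) (φ : W →ₗ[PathAlgebra k I ⧸ J] E)
      (f : EvenCochain J r V E), Function.Injective φ ∧
        dEven J r V E f = fun i j α => vmap J φ j ∘ₗ g i j α := by
  obtain ⟨E, _, _, _, _, φ, f, hφ, hf⟩ := exists_inner.{u, w, t, v} g.deriv g.deriv_mul (g.deriv_eq_zero hg)
  -- Since D_g kills the trivial paths, f commutes with every e_i and therefore respects vertex
  -- components.
  have hf1 : ∀ (i : I) (x : vpart J (GrTensor J r V) i), f x ∈ vpart J E i := by
    intro i x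
    have := hf (vtx k i) x
    rw [mem_vpart.1 x.2, OddCochain.deriv, deriv_vtx, LinearMap.zero_apply, map_zero,
      sub_eq_zero] at this
    exact mem_vpart.2 this.symm
  refine ⟨E, _, _, _, _, φ, fun i => f.restrict fun x hx => hf1 i ⟨x, hx⟩, hφ, ?_⟩
  funext i j α
  refine LinearMap.ext fun x => Subtype.ext ?_
  refine (hf (arr k α) x).trans ?_
  rw [g.deriv_arr]
  change φ (g i j α (vproj J _ i x)) = φ (g i j α x)
  rw [vproj_coe]

end Extension

/-! ### Coinduced modules -/

section CoInd

variable (k A U : Type*) [Field k] [Ring A] [Algebra k A] [AddCommGroup U] [Module k U]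

/-- The coinduced left `A`-module `Hom_k(A, U)`. -/
def CoInd := A →ₗ[k] U

instance : AddCommGroup (CoInd k A U) := inferInstanceAs (AddCommGroup (A →ₗ[k] U))

instance : Module k (CoInd k A U) := inferInstanceAs (Module k (A →ₗ[k] U))

instance : Module A (CoInd k A U) where
  smul a φ := LinearMap.comp (show A →ₗ[k] U from φ) (LinearMap.mulRight k a)
  one_smul := fun (φ : A →ₗ[k] U) => LinearMap.ext fun x => congrArg φ (mul_one x)
  mul_smul := fun a b (φ : A →ₗ[k] U) =>
    LinearMap.ext fun x => congrArg φ (mul_assoc x a b).symm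
  smul_zero _ := LinearMap.zero_comp _
  smul_add _ _ _ := LinearMap.add_comp _ _ _
  add_smul := fun a b (φ : A →ₗ[k] U) =>
    LinearMap.ext fun x => (congrArg φ (mul_add x a b)).trans (map_add φ _ _)
  zero_smul := fun (φ : A →ₗ[k] U) =>
    LinearMap.ext fun x => (congrArg φ (mul_zero x)).trans (map_zero φ)

instance : IsScalarTower k A (CoInd k A U) := ⟨fun c a (φ : A →ₗ[k] U) => LinearMap.ext fun x =>
  (congrArg φ (mul_smul_comm c x a)).trans (map_smul φ c _)⟩

instance [Small.{v} A] [Small.{v} U] : Small.{v} (CoInd k A U) :=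
  small_of_injective (β := A → U) (DFunLike.coe_injective (F := A →ₗ[k] U))

variable {k A U}

/-- Evaluation of an element of `Hom_k(A, U)`. -/
def CoInd.eval (a : A) : CoInd k A U →ₗ[k] U := LinearMap.applyₗ (R := k) (M := A) a

theorem CoInd.ext {φ ψ : CoInd k A U} (h : ∀ a, CoInd.eval a φ = CoInd.eval a ψ) : φ = ψ :=
  LinearMap.ext h

theorem CoInd.eval_smul (a b : A) (φ : CoInd k A U) :
    CoInd.eval a (b • φ) = CoInd.eval (a * b) φ := rfl

variable (k A U) in
/-- The unit `U → Hom_k(A, U)` for an `A`-module `U`. -/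
def CoInd.unit [Module A U] [IsScalarTower k A U] : U →ₗ[A] CoInd k A U where
  toFun x := (LinearMap.toSpanSingleton A U x).restrictScalars k
  map_add' x y := LinearMap.ext fun a => smul_add a x y
  map_smul' b x := LinearMap.ext fun a => (smul_smul a b x :)

theorem CoInd.eval_unit [Module A U] [IsScalarTower k A U] (a : A) (x : U) :
    CoInd.eval a (CoInd.unit k A U x) = a • x := rfl

/-- Evaluation at 1 is a left inverse. -/
theorem CoInd.unit_injective [Module A U] [IsScalarTower k A U] :
    Function.Injective (CoInd.unit k A U) := fun x y h => by
  have := congrArg (CoInd.eval 1) h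
  rwa [CoInd.eval_unit, CoInd.eval_unit, one_smul, one_smul] at this

end CoInd

theorem exists_factor {R M N P : Type*} [Ring R] [AddCommGroup M] [Module R M] [AddCommGroup N]
    [Module R N] [AddCommGroup P] [Module R P] (π : M →ₗ[R] N) (hπ : Function.Surjective π)
    (T : M →ₗ[R] P) (hT : ∀ x, π x = 0 → T x = 0) : ∃ F : N →ₗ[R] P, ∀ x, F (π x) = T x := by
  refine ⟨(LinearMap.ker π).liftQ T hT ∘ₗ (π.quotKerEquivOfSurjective hπ).symm.toLinearMap,
    fun x => ?_⟩
  have : (π.quotKerEquivOfSurjective hπ).symm (π x) = (LinearMap.ker π).mkQ x := by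
    rw [LinearEquiv.symm_apply_eq]
    rfl
  rw [LinearMap.comp_apply, LinearEquiv.coe_coe, this]
  rfl

/-! ### Derivations from balanced maps, and an injective connecting map -/

section Derivation

variable {k : Type u} [Field k] {I : Type w} [Quiver.{t + 1} I] [Fintype I]
variable {J : Ideal (PathAlgebra k I)} [J.IsTwoSided]

/-- A linear map on `J` with values in `Hom_k(X, U)` that is balanced over the path algebra
extends to a linear map `M` on the path algebra whose failure `D` to be balanced is a derivation
with values in `Hom_k(X, Hom_k(A, U))`. -/
theorem exists_derivation_of_balanced {X U : Type*} [AddCommGroup X] [Module k X]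
    [AddCommGroup U] [Module k U] (ρ : PathAlgebra k I →ₐ[k] Module.End k X)
    (m : J →ₗ[k] X →ₗ[k] U)
    (hm : ∀ (s : J) (a : PathAlgebra k I) (x : X), m ⟨s * a, J.mul_mem_right a s.2⟩ x = m s (ρ a x)) :
    ∃ (M : PathAlgebra k I →ₗ[k] X →ₗ[k] U)
      (D : PathAlgebra k I →ₗ[k] X →ₗ[k] CoInd k (PathAlgebra k I ⧸ J) U),
      (∀ s : J, M s = m s) ∧
      (∀ a b x, CoInd.eval (Ideal.Quotient.mk J a) (D b x) = M (a * b) x - M a (ρ b x)) ∧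
      (∀ i, D (vtx k i) = 0) ∧
      ∀ a b, D (a * b) = rep J _ a ∘ₗ D b + D a ∘ₗ ρ b := by
  obtain ⟨p, hp⟩ := exists_retraction J
  -- Any linear extension m ∘ p would make the defect a derivation. Averaging over the vertices, a ↦
  -- ∑ m(p(a e_i)) e_i, makes M balanced for the e_i as well, so that D(e_i) = 0, and changes
  -- nothing on J.
  let M : PathAlgebra k I →ₗ[k] X →ₗ[k] U := ∑ i : I,
    (LinearMap.llcomp k X X U).flip (ρ (vtx k i)) ∘ₗ (m ∘ₗ p) ∘ₗ (mulLin k).flip (vtx k i)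
  have hM : ∀ a x, M a x = ∑ i : I, m (p (a * vtx k i)) (ρ (vtx k i) x) := by
    intro a x
    rw [LinearMap.sum_apply, LinearMap.sum_apply]
    rfl
  have hMJ : ∀ s : J, M s = m s := by
    intro s
    refine LinearMap.ext fun x => ?_
    have h1 : ∀ i : I, m (p (s * vtx k i)) (ρ (vtx k i) x) = m s (ρ (vtx k i) x) := by
      intro i
      have := hp ⟨s * vtx k i, J.mul_mem_right _ s.2⟩
      rw [this, hm, ← Module.End.mul_apply, ← map_mul, vtx_mul_vtx]
    rw [hM, Finset.sum_congr rfl fun i _ => h1 i, ← map_sum, ← LinearMap.sum_apply, ← map_sum]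
    change m s (ρ 1 x) = m s x
    rw [map_one]
    rfl
  have hMv : ∀ a i x, M (a * vtx k i) x = M a (ρ (vtx k i) x) := by
    intro a i x
    rw [hM, hM, Finset.sum_eq_single i, Finset.sum_eq_single i]
    · rw [mul_assoc, vtx_mul_vtx, ← Module.End.mul_apply, ← map_mul, vtx_mul_vtx]
    · intro j _ hj
      rw [← Module.End.mul_apply, ← map_mul, vtx_mul_vtx_ne hj, map_zero, LinearMap.zero_apply,
        map_zero]
    · intro h
      exact absurd (Finset.mem_univ _) h
    · intro j _ hj
      rw [mul_assoc, vtx_mul_vtx_ne hj.symm, mul_zero, map_zero, map_zero, LinearMap.zero_apply]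
    · intro h
      exact absurd (Finset.mem_univ _) h
  have hMs : ∀ (s : PathAlgebra k I) (_ : s ∈ J) (b x), M (s * b) x = M s (ρ b x) := by
    intro s hs b x
    have h1 := hMJ ⟨s * b, J.mul_mem_right b hs⟩
    have h2 := hMJ ⟨s, hs⟩
    rw [h1, h2, ← hm]
  -- The defect M(ab)x - M(a)(bx) vanishes for a in J by `hMs`. So it can be defined on A through a
  -- linear section, and `hE` shows that any lift of a may be used.
  obtain ⟨σ, hσ⟩ := (Ideal.Quotient.mkₐ k J).toLinearMap.exists_rightInverse_of_surjective
    (LinearMap.range_eq_top.2 (Ideal.Quotient.mkₐ_surjective k J))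
  let E : PathAlgebra k I → X → CoInd k (PathAlgebra k I ⧸ J) U := fun b x =>
    LinearMap.comp ((M ∘ₗ (mulLin k).flip b).flip x - M.flip (ρ b x)) σ
  have hE : ∀ a b x, CoInd.eval (Ideal.Quotient.mk J a) (E b x) = M (a * b) x - M a (ρ b x) := by
    intro a b x
    change M (σ (Ideal.Quotient.mk J a) * b) x - M (σ (Ideal.Quotient.mk J a)) (ρ b x) = _
    have h1 : σ (Ideal.Quotient.mk J a) - a ∈ J := by
      rw [← Ideal.Quotient.eq]
      exact congr($hσ (Ideal.Quotient.mk J a))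
    have h2 := hMs _ h1 b x
    rw [sub_mul, map_sub, map_sub, LinearMap.sub_apply, LinearMap.sub_apply] at h2
    rw [sub_eq_sub_iff_add_eq_add] at h2
    rw [sub_eq_sub_iff_add_eq_add, h2, add_comm]
  have hE' : ∀ {φ ψ : CoInd k (PathAlgebra k I ⧸ J) U},
      (∀ a, CoInd.eval (Ideal.Quotient.mk J a) φ = CoInd.eval (Ideal.Quotient.mk J a) ψ) →
      φ = ψ := by
    intro φ ψ h
    refine CoInd.ext fun a => ?_
    obtain ⟨a, rfl⟩ := Ideal.Quotient.mk_surjective a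
    exact h a
  let D : PathAlgebra k I →ₗ[k] X →ₗ[k] CoInd k (PathAlgebra k I ⧸ J) U := LinearMap.mk₂ k E
    (fun b b' x => hE' fun a => by
      rw [map_add, hE, hE, hE, mul_add, map_add, map_add, LinearMap.add_apply,
        LinearMap.add_apply, map_add]
      abel)
    (fun c b x => hE' fun a => by
      rw [map_smul, hE, hE, mul_smul_comm, map_smul, map_smul, LinearMap.smul_apply,
        LinearMap.smul_apply, map_smul, smul_sub])
    (fun b x x' => hE' fun a => by
      rw [map_add, hE, hE, hE, map_add, map_add, map_add]
      abel)
    (fun c b x => hE' fun a => by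
      rw [map_smul, hE, hE, map_smul, map_smul, map_smul, smul_sub])
  have hD : ∀ a b x, CoInd.eval (Ideal.Quotient.mk J a) (D b x) = M (a * b) x - M a (ρ b x) := hE
  refine ⟨M, D, hMJ, hD, fun i => ?_, fun a b => ?_⟩
  · refine LinearMap.ext fun x => hE' fun a => ?_
    rw [hD, hMv, sub_self, LinearMap.zero_apply, map_zero]
  -- The Leibniz rule is a telescoping sum: M(cab)x - M(c)(abx) = (M(cab)x - M(ca)(bx)) + (M(ca)(bx)
  -- - M(c)(abx)).
  · refine LinearMap.ext fun x => hE' fun c => ?_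
    rw [LinearMap.add_apply, map_add, hD, LinearMap.comp_apply, LinearMap.comp_apply, rep_apply,
      CoInd.eval_smul, ← map_mul, hD, hD, map_mul ρ, mul_assoc, Module.End.mul_apply]
    abel

variable {r : ℕ} {V : Type v} [AddCommGroup V] [Module (PathAlgebra k I ⧸ J) V]

variable (r) in
/-- Multiplication by `s ∈ J` on the left, as a map `A^r → A^{r+1}`. -/
theorem Gr.exists_lmul (s : J) : ∃ f : Gr J r →ₗ[k] Gr J (r + 1),
    ∀ x, f (Gr.mk J r x) = Gr.mk J (r + 1) (mulPow s x) := by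
  let T : ↥(J ^ r) →ₗ[k] Gr J (r + 1) :=
    { toFun := fun x => Gr.mk J (r + 1) (mulPow s x)
      map_add' := fun x y => by
        rw [← map_add]
        exact congrArg _ (Subtype.ext (mul_add _ _ _))
      map_smul' := fun c x => by
        rw [RingHom.id_apply]
        refine Eq.trans ?_ (((Gr.mk J (r + 1)).restrictScalars k).map_smul c (mulPow s x))
        exact congrArg _ (Subtype.ext (mul_smul_comm _ _ _)) }
  refine exists_factor ((Gr.mk J r).restrictScalars k) (Gr.mk_surjective J r) T fun x hx => ?_
  -- A representative x in J^(r+1) gives sx in J^(r+2), so the class of sx depends only on that of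
  -- x.
  refine Gr.mk_eq_zero J (r + 1) _ ?_
  have hx' : (x : PathAlgebra k I) ∈ J ^ (r + 1) :=
    (Submodule.Quotient.mk_eq_zero ((J ^ (r + 1)).submoduleOf (J ^ r))).1 hx
  exact (mulPow s (⟨x, hx'⟩ : ↥(J ^ (r + 1)))).2

variable (J r V) in
/-- Multiplication by elements of `J` on the left, as maps `A^r ⊗ V → A^{r+1} ⊗_A V`. -/
theorem exists_lmul_tensor : ∃ T : J → Gr J r ⊗[ℤ] V →ₗ[k] GrTensor J (r + 1) V,
    (∀ s x v, T s (Gr.mk J r x ⊗ₜ v) = GrTensor.tmul J (r + 1) (mulPow s x) v) ∧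
    ∀ s, ∀ z ∈ balancedRel (PathAlgebra k I ⧸ J) (PathAlgebra k I ⧸ J) (Gr J r) V, T s z = 0 := by
  choose f hf using Gr.exists_lmul (J := J) r
  let T : J → Gr J r ⊗[ℤ] V →ₗ[k] GrTensor J (r + 1) V := fun s =>
    ((GrTensor.proj J (r + 1) V).restrictScalars k) ∘ₗ
      TensorProduct.AlgebraTensorModule.map (f s) LinearMap.id
  have hT : ∀ s x v, T s (Gr.mk J r x ⊗ₜ v) = GrTensor.tmul J (r + 1) (mulPow s x) v := by
    intro s x v
    change GrTensor.proj J (r + 1) V (f s (Gr.mk J r x) ⊗ₜ v) = _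
    rw [hf]
    rfl
  -- The relations form an A-span, but T s is only k-linear. A scalar a is absorbed into s, so the
  -- vanishing on relations is proved for all s simultaneously.
  have hTs : ∀ s a z, T s (Ideal.Quotient.mk J a • z) = T ⟨s * a, J.mul_mem_right a s.2⟩ z := by
    intro s a z
    induction z with
    | zero => rw [smul_zero, map_zero, map_zero]
    | tmul y v =>
      obtain ⟨x, rfl⟩ := Gr.mk_surjective J r y
      refine (hT s (a • x) v).trans (Eq.trans ?_ (hT _ x v).symm)
      congr 1
      exact Subtype.ext (mul_assoc _ _ _).symm
    | add x y hx hy => rw [smul_add, map_add, map_add, hx, hy]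
  have hT0 : ∀ z ∈ balancedRel (PathAlgebra k I ⧸ J) (PathAlgebra k I ⧸ J) (Gr J r) V,
      ∀ s, T s z = 0 := by
    intro z hz
    refine Submodule.span_induction ?_ ?_ ?_ ?_ hz
    · rintro _ ⟨y, a, v, rfl⟩ s
      obtain ⟨x, rfl⟩ := Gr.mk_surjective J r y
      obtain ⟨a, rfl⟩ := Ideal.Quotient.mk_surjective a
      rw [map_sub, Gr.op_mk_smul, hT, hT, GrTensor.tmul_smul, sub_eq_zero]
      congr 1
      exact Subtype.ext (mul_assoc _ _ _).symm
    · exact fun s => map_zero _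
    · intro x y _ _ hx hy s
      rw [map_add, hx, hy, add_zero]
    · intro a x _ hx s
      obtain ⟨a, rfl⟩ := Ideal.Quotient.mk_surjective a
      rw [hTs, hx]
  exact ⟨T, hT, fun s z hz => hT0 z hz s⟩

theorem GrTensor.proj_surjective : Function.Surjective (GrTensor.proj J r V) :=
  Submodule.mkQ_surjective (balancedRel (PathAlgebra k I ⧸ J) (PathAlgebra k I ⧸ J) (Gr J r) V)

theorem GrTensor.mem_balancedRel_of_proj_eq_zero {z : Gr J r ⊗[ℤ] V}
    (hz : GrTensor.proj J r V z = 0) :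
    z ∈ balancedRel (PathAlgebra k I ⧸ J) (PathAlgebra k I ⧸ J) (Gr J r) V :=
  (Submodule.Quotient.mk_eq_zero
    (balancedRel (PathAlgebra k I ⧸ J) (PathAlgebra k I ⧸ J) (Gr J r) V)).1 hz

variable (J r V) in
/-- Multiplication by elements of `J` on the left, as maps `A^r ⊗_A V → A^{r+1} ⊗_A V`. -/
theorem exists_lmul_grTensor (s : J) : ∃ F : GrTensor J r V →ₗ[k] GrTensor J (r + 1) V,
    ∀ x v, F (GrTensor.tmul J r x v) = GrTensor.tmul J (r + 1) (mulPow s x) v := by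
  obtain ⟨T, hT, hT0⟩ := exists_lmul_tensor J r V
  let π : Gr J r ⊗[ℤ] V →ₗ[k] GrTensor J r V := (GrTensor.proj J r V).restrictScalars k
  have hπ : Function.Surjective π := GrTensor.proj_surjective
  have hT' : ∀ z, π z = 0 → T s z = 0 := fun z hz =>
    hT0 s z (GrTensor.mem_balancedRel_of_proj_eq_zero hz)
  obtain ⟨F, hF⟩ := exists_factor π hπ (T s) hT'
  refine ⟨F, fun x v => ?_⟩
  rw [← hT]
  exact hF (Gr.mk J r x ⊗ₜ v)

variable (J r V) in
/-- The multiplication map `J × (A^r ⊗_A V) → A^{r+1} ⊗_A V`. -/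
theorem exists_mulTensor :
    ∃ m : J →ₗ[k] GrTensor J r V →ₗ[k] GrTensor J (r + 1) V,
      ∀ s x v, m s (GrTensor.tmul J r x v) = GrTensor.tmul J (r + 1) (mulPow s x) v := by
  choose F hF' using exists_lmul_grTensor J r V
  have hext : ∀ {G G' : GrTensor J r V →ₗ[k] GrTensor J (r + 1) V},
      (∀ x v, G (GrTensor.tmul J r x v) = G' (GrTensor.tmul J r x v)) → G = G' := by
    intro G G' h
    refine LinearMap.ext fun z => ?_
    refine GrTensor.induction J r (p := fun z => G z = G' z) ?_ ?_ h z
    · rw [map_zero, map_zero]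
    · intro x y hx hy
      rw [map_add, map_add, hx, hy]
  refine ⟨{ toFun := F, map_add' := fun s s' => hext fun x v => ?_,
            map_smul' := fun c s => hext fun x v => ?_ }, hF'⟩
  · rw [LinearMap.add_apply, hF', hF', hF', ← GrTensor.tmul_add_left]
    congr 1
    exact Subtype.ext (add_mul _ _ _)
  · rw [RingHom.id_apply, LinearMap.smul_apply, hF', hF']
    refine Eq.trans ?_ (algebraMap_smul (PathAlgebra k I ⧸ J) c (GrTensor.tmul J (r + 1) (mulPow s x) v))
    refine Eq.trans ?_ (GrTensor.smul_tmul J (r + 1) (algebraMap k (PathAlgebra k I) c) _ v).symm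
    congr 1
    refine Subtype.ext ?_
    change (c • (s : PathAlgebra k I)) * x = algebraMap k (PathAlgebra k I) c * (s * x)
    rw [← Algebra.smul_def, smul_mul_assoc]

/-- A derivation that vanishes on the trivial paths comes from an odd cochain. -/
theorem OddCochain.exists_deriv_eq {W : Type v} [AddCommGroup W] [Module (PathAlgebra k I ⧸ J) W]
    [Module k W] [IsScalarTower k (PathAlgebra k I ⧸ J) W]
    (D : PathAlgebra k I →ₗ[k] GrTensor J r V →ₗ[k] W) (hv : ∀ i, D (vtx k i) = 0)
    (hD : ∀ a b, D (a * b) = rep J W a ∘ₗ D b + D a ∘ₗ rep J _ b) :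
    ∃ g : OddCochain J r V W, g.deriv = D := by
  let g : OddCochain J r V W := fun i j α => vproj J W j ∘ₗ D (arr k α) ∘ₗ Submodule.subtype _
  have hg : ∀ ⦃i j : I⦄ (α : i ⟶ j), g.ext α = D (arr k α) := by
    intro i j α
    -- The Leibniz rule for α = α e_{t(α)} = e_{h(α)} α, together with D(e_i) = 0, confines D(α) to
    -- maps from the tail component to the head component.
    have h1 : D (arr k α) = D (arr k α) ∘ₗ rep J _ (vtx k i) := by
      conv_lhs => rw [← arr_mul_vtx, hD, hv, LinearMap.comp_zero, zero_add]
    have h2 : D (arr k α) = rep J W (vtx k j) ∘ₗ D (arr k α) := by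
      conv_lhs => rw [← vtx_mul_arr, hD, hv, LinearMap.zero_comp, add_zero]
    change rep J W (vtx k j) ∘ₗ D (arr k α) ∘ₗ rep J _ (vtx k i) = _
    rw [← h1, ← h2]
  refine ⟨g, lin_ext fun i j p => ?_⟩
  rw [OddCochain.deriv, deriv_ofPath]
  induction p with
  | nil => exact (hv i).symm
  | cons p α ih => rw [pathDeriv, ih, hg, ofPath_cons, hD]

variable (J r V) in
/-- `A^{r+1} ⊗_A V` embeds into a module such that the embedding is the connecting map of an odd
cochain. -/
theorem exists_connecting_injective [Small.{v} (PathAlgebra k I ⧸ J)]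
    [Small.{v} (GrTensor J (r + 1) V)] :
    ∃ (E : Type v) (_ : AddCommGroup E) (_ : Module (PathAlgebra k I ⧸ J) E) (_ : Module k E)
      (_ : IsScalarTower k (PathAlgebra k I ⧸ J) E) (g : OddCochain J r V E),
      Function.Injective (connecting g) := by
  obtain ⟨m, hm⟩ := exists_mulTensor J r V
  obtain ⟨M, D, hM, hMD, hDv, hD⟩ := exists_derivation_of_balanced
    (rep J (GrTensor J r V)) m (fun s a z => by
      refine GrTensor.induction J r (p := fun z =>
        m ⟨s * a, J.mul_mem_right a s.2⟩ z = m s (rep J _ a z)) ?_ ?_ ?_ z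
      · rw [map_zero, map_zero, map_zero]
      · intro x y hx hy
        rw [map_add, map_add, map_add, hx, hy]
      · intro x v
        rw [hm, rep_apply, GrTensor.smul_tmul, hm]
        congr 1
        exact Subtype.ext (mul_assoc _ _ _))
  let C := CoInd k (PathAlgebra k I ⧸ J) (GrTensor J (r + 1) V)
  let e : Shrink.{v} C ≃ₗ[PathAlgebra k I ⧸ J] C := Shrink.linearEquiv (PathAlgebra k I ⧸ J) C
  have : IsScalarTower k (PathAlgebra k I ⧸ J) (Shrink.{v} C) := isScalarTower_shrink k _ _
  let D' : PathAlgebra k I →ₗ[k] GrTensor J r V →ₗ[k] Shrink.{v} C :=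
    (LinearMap.llcomp k _ _ _ (Shrink.linearEquiv k C).symm.toLinearMap) ∘ₗ D
  have hD' : ∀ a z, D' a z = e.symm (D a z) := fun a z => rfl
  obtain ⟨g, hg⟩ := OddCochain.exists_deriv_eq D' (fun i => LinearMap.ext fun z => by
      rw [hD', hDv]
      exact map_zero e.symm) (fun a b => LinearMap.ext fun z => by
      rw [hD', hD]
      change e.symm (Ideal.Quotient.mk J a • D b z + D a (rep J _ b z)) =
        Ideal.Quotient.mk J a • e.symm (D b z) + e.symm (D a (rep J _ b z))
      rw [map_add, map_smul])
  refine ⟨Shrink.{v} C, inferInstance, inferInstance, inferInstance, this, g, ?_⟩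
  -- For s in J the defect at a is M(as)z - M(a)(sz). Here as lies in J, where M is the
  -- multiplication map, and s acts on z by zero; what remains is a times the product of s and z.
  have H : connecting g = e.symm.toLinearMap ∘ₗ CoInd.unit k _ _ := by
    refine connecting_unique fun s x v => ?_
    rw [connecting_tmul, hg, hD']
    change e.symm _ = e.symm _
    congr 1
    refine CoInd.ext fun a => ?_
    obtain ⟨a, rfl⟩ := Ideal.Quotient.mk_surjective a
    have h1 := hM ⟨a * s, J.mul_mem_left a s.2⟩
    rw [hMD, CoInd.eval_unit, h1, hm, rep_eq_zero J _ s.2, LinearMap.zero_apply, map_zero,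
      sub_zero, GrTensor.smul_tmul]
    congr 1
    exact Subtype.ext (mul_assoc _ _ _)
  rw [H]
  exact e.symm.injective.comp CoInd.unit_injective

end Derivation

/-! ### Flatness of J as a right module -/

section Flat

/-- The additive subgroup of relations of a tensor product is stable under scalars that commute
with the ring. -/
theorem balancedRel_le_int (k : Type*) {R M N : Type*} [CommRing k] [Ring R] [AddCommGroup M]
    [Module k M] [Module Rᵐᵒᵖ M] [SMulCommClass k Rᵐᵒᵖ M] [AddCommGroup N] [Module R N]
    {z : M ⊗[ℤ] N} (hz : z ∈ balancedRel k R M N) : z ∈ balancedRel ℤ R M N := by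
  have hsmul : ∀ (c : k) (z : M ⊗[ℤ] N), z ∈ balancedRel ℤ R M N → c • z ∈ balancedRel ℤ R M N := by
    intro c z hz
    refine Submodule.span_induction ?_ ?_ ?_ ?_ hz
    · rintro _ ⟨m, a, n, rfl⟩
      refine Submodule.subset_span ⟨c • m, a, n, ?_⟩
      rw [smul_sub, TensorProduct.smul_tmul', TensorProduct.smul_tmul', smul_comm]
    · rw [smul_zero]
      exact zero_mem _
    · intro x y _ _ hx hy
      rw [smul_add]
      exact add_mem hx hy
    · intro n x _ hx
      rw [smul_comm]
      exact Submodule.smul_mem _ n hx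
  refine Submodule.span_induction ?_ (zero_mem _) (fun x y _ _ => add_mem)
    (fun c x _ hx => hsmul c x hx) hz
  rintro _ ⟨m, a, n, rfl⟩
  exact Submodule.subset_span ⟨m, a, n, rfl⟩

variable {k : Type u} [Field k] {I : Type w} [Quiver.{t + 1} I] [Fintype I]
variable (J : Ideal (PathAlgebra k I)) [J.IsTwoSided]

variable {J} in
/-- A balanced linear map on `J` with values in `Hom_k(N, U)` extends along an injection
`N → N'`. -/
theorem exists_balanced_extension {N N' U : Type*} [AddCommGroup N] [Module k N]
    [AddCommGroup N'] [Module k N'] [AddCommGroup U] [Module k U]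
    (ρ : PathAlgebra k I →ₐ[k] Module.End k N) (ρ' : PathAlgebra k I →ₐ[k] Module.End k N')
    (f : N →ₗ[k] N') (hf : Function.Injective f) (hρ : ∀ a x, f (ρ a x) = ρ' a (f x))
    (m : J →ₗ[k] N →ₗ[k] U)
    (hm : ∀ (s : J) (a : PathAlgebra k I) (x : N),
      m ⟨s * a, J.mul_mem_right a s.2⟩ x = m s (ρ a x)) :
    ∃ m' : PathAlgebra k I →ₗ[k] N' →ₗ[k] U, (∀ (s : J) (x : N), m' s (f x) = m s x) ∧
      ∀ (s : J) (a : PathAlgebra k I) (x : N'), m' (s * a) x = m' s (ρ' a x) := by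
  obtain ⟨M, D, hM, hMD, hDv, hD⟩ := exists_derivation_of_balanced ρ m hm
  obtain ⟨π, hπ⟩ := f.exists_leftInverse_of_injective (LinearMap.ker_eq_bot.2 hf)
  have hπ : ∀ x, π (f x) = x := fun x => congr($hπ x)
  let σ := rep J (CoInd k (PathAlgebra k I ⧸ J) U)
  -- The values D(α) are carried to N' through the k-linear retraction π. No compatibility of π with
  -- the action is needed, because arrows generate kQ freely over the trivial paths; the idempotents
  -- on both sides supply the hypotheses of `deriv_mul`.
  let G : ∀ ⦃i j : I⦄, (i ⟶ j) → (N' →ₗ[k] CoInd k (PathAlgebra k I ⧸ J) U) := fun i j α =>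
    σ (vtx k j) ∘ₗ D (arr k α) ∘ₗ π ∘ₗ ρ' (vtx k i)
  have hG1 : ∀ ⦃i j : I⦄ (α : i ⟶ j), G α ∘ₗ ρ' (vtx k i) = G α := by
    intro i j α
    refine LinearMap.ext fun x => ?_
    change σ (vtx k j) (D (arr k α) (π (ρ' (vtx k i) (ρ' (vtx k i) x)))) = _
    rw [← Module.End.mul_apply, ← map_mul, vtx_mul_vtx]
    rfl
  have hG2 : ∀ ⦃i j : I⦄ (α : i ⟶ j), σ (vtx k j) ∘ₗ G α = G α := by
    intro i j α
    refine LinearMap.ext fun x => ?_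
    change σ (vtx k j) (σ (vtx k j) (D (arr k α) (π (ρ' (vtx k i) x)))) = _
    rw [← Module.End.mul_apply, ← map_mul, vtx_mul_vtx]
    rfl
  have hGf : ∀ ⦃i j : I⦄ (α : i ⟶ j) x, G α (f x) = D (arr k α) x := by
    intro i j α x
    have h1 : D (arr k α) = D (arr k α) ∘ₗ ρ (vtx k i) := by
      conv_lhs => rw [← arr_mul_vtx, hD, hDv, LinearMap.comp_zero, zero_add]
    have h2 : D (arr k α) = σ (vtx k j) ∘ₗ D (arr k α) := by
      conv_lhs => rw [← vtx_mul_arr, hD, hDv, LinearMap.zero_comp, add_zero]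
    change σ (vtx k j) (D (arr k α) (π (ρ' (vtx k i) (f x)))) = _
    rw [← hρ, hπ]
    exact (congr($h2 (ρ (vtx k i) x))).symm.trans congr($h1 x).symm
  let D' := deriv ρ' σ G
  have hD' : ∀ a b, D' (a * b) = σ a ∘ₗ D' b + D' a ∘ₗ ρ' b := deriv_mul ρ' σ G hG1 hG2
  have hDf : ∀ a x, D' a (f x) = D a x := by
    have H : (LinearMap.lcomp k _ f) ∘ₗ D' = D := by
      refine lin_ext fun i j p => LinearMap.ext fun x => ?_
      change D' (ofPath k p) (f x) = D (ofPath k p) x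
      induction p with
      | nil =>
        refine Eq.trans ?_ (congr($(hDv i) x)).symm
        exact congr($(deriv_vtx ρ' σ G i) (f x))
      | cons p α ih =>
        rw [ofPath_cons, hD', hD, LinearMap.add_apply, LinearMap.comp_apply, ih,
          LinearMap.comp_apply, ← hρ, LinearMap.add_apply, LinearMap.comp_apply,
          LinearMap.comp_apply]
        congr 1
        refine Eq.trans ?_ (hGf α (ρ (ofPath k p) x))
        refine congrArg (fun φ : N' →ₗ[k] CoInd k (PathAlgebra k I ⧸ J) U =>
          φ (f (ρ (ofPath k p) x))) ?_
        refine (deriv_ofPath ρ' σ G α.toPath).trans ?_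
        change σ (arr k α) ∘ₗ 0 + G α ∘ₗ ρ' (vtx k _) = G α
        rw [LinearMap.comp_zero, zero_add, hG1]
    exact fun a x => congr($H a x)
  -- Evaluating the defect at 1 gives M(b)x = M(1)(bx) + D(b)x at 1, so M is recovered from M(1) and
  -- D. The same formula with M(1) ∘ π and D' defines m'. It is balanced on J because J acts by zero
  -- on the coinduced module, so D'(sa) = D'(s) ∘ a.
  let m' : PathAlgebra k I →ₗ[k] N' →ₗ[k] U :=
    LinearMap.llcomp k N' N' U (M 1 ∘ₗ π) ∘ₗ ρ'.toLinearMap +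
      LinearMap.llcomp k N' _ U (CoInd.eval (Ideal.Quotient.mk J 1)) ∘ₗ D'
  have hm' : ∀ a x, m' a x = M 1 (π (ρ' a x)) + CoInd.eval (Ideal.Quotient.mk J 1) (D' a x) :=
    fun a x => rfl
  refine ⟨m', fun s x => ?_, fun s a x => ?_⟩
  · rw [hm', hDf, ← hρ, hπ, hMD, one_mul, hM]
    abel
  · have h0 : σ s = 0 := rep_eq_zero J _ s.2
    rw [hm', hm', hD', map_mul, h0, LinearMap.zero_comp, zero_add]
    rfl

/-- The canonical balanced map J × N → J ⊗ N extends to J × N', and the extension composed with id ⊗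
f is the canonical map again. So an element killed by id ⊗ f is zero. -/
theorem rightFlat_asRight : RightFlat (PathAlgebra k I) (asRight J) := by
  intro N N' _ _ _ _ f hf
  let _ : Module k N := Module.compHom N (algebraMap k (PathAlgebra k I))
  let _ : Module k N' := Module.compHom N' (algebraMap k (PathAlgebra k I))
  have hN : ∀ (c : k) (x : N), c • x = algebraMap k (PathAlgebra k I) c • x := fun c x => rfl
  have : IsScalarTower k (PathAlgebra k I) N := ⟨fun c a x => by
    rw [hN, Algebra.smul_def, mul_smul]⟩
  have : IsScalarTower k (PathAlgebra k I) N' := ⟨fun c a x => by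
    rw [Algebra.smul_def, mul_smul]
    rfl⟩
  have hJ' : ∀ (c : k) (s : asRight J),
      ((c • s : asRight J) : PathAlgebra k I) = c • (s : PathAlgebra k I) := fun c s => rfl
  have hJ : ∀ (c : k) (s : asRight J),
      c • s = MulOpposite.op (algebraMap k (PathAlgebra k I) c) • s := fun c s => Subtype.ext (by
    change c • (s : PathAlgebra k I) = (s : PathAlgebra k I) * algebraMap k (PathAlgebra k I) c
    rw [Algebra.smul_def, Algebra.commutes])
  have : SMulCommClass k (PathAlgebra k I)ᵐᵒᵖ (asRight J) := ⟨fun c a s => Subtype.ext (by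
    rw [hJ']
    change c • ((s : PathAlgebra k I) * a.unop) = (((c • s : asRight J) : PathAlgebra k I)) * a.unop
    rw [hJ', smul_mul_assoc])⟩
  -- The tensor product is formed with k-spans in order to be a vector space; `balancedRel_le_int`
  -- returns to the additive subgroup of relations at the end.
  let U := BTensor k (PathAlgebra k I) (asRight J) N
  let q : asRight J ⊗[ℤ] N →ₗ[k] U := (balancedRel k (PathAlgebra k I) (asRight J) N).mkQ
  have hq : ∀ (s : asRight J) (a : PathAlgebra k I) (n : N),
      q ((MulOpposite.op a • s) ⊗ₜ n) = q (s ⊗ₜ (a • n)) := fun s a n =>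
    (Submodule.Quotient.eq _).2 (Submodule.subset_span ⟨s, a, n, rfl⟩)
  let toJ : J → asRight J := fun s => ⟨s, s.2⟩
  let m : J →ₗ[k] N →ₗ[k] U := LinearMap.mk₂ k (fun s n => q (toJ s ⊗ₜ n))
    (fun s s' n => by
      rw [← map_add, ← TensorProduct.add_tmul]
      rfl)
    (fun c s n => by
      rw [← map_smul, TensorProduct.smul_tmul']
      congr 2)
    (fun s n n' => by
      rw [← map_add, ← TensorProduct.tmul_add])
    (fun c s n => by
      rw [← map_smul, TensorProduct.smul_tmul', hJ, hq, hN])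
  obtain ⟨m', hm1, hm2⟩ := exists_balanced_extension (Algebra.lsmul k k N) (Algebra.lsmul k k N')
    (f.restrictScalars k) hf (fun a x => map_smul f a x) m (fun s a n => hq (toJ s) a n)
  let β : asRight J ⊗[ℤ] N' →ₗ[ℤ] U := TensorProduct.lift (LinearMap.mk₂ ℤ
    (fun s n => m' s n)
    (fun s s' n => by
      rw [Submodule.coe_add, map_add, LinearMap.add_apply])
    (fun c s n => by
      have : ((c • s : asRight J) : PathAlgebra k I) = c • (s : PathAlgebra k I) := rfl
      rw [this, map_zsmul, LinearMap.smul_apply])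
    (fun s n n' => map_add _ _ _)
    (fun c s n => map_zsmul _ _ _))
  have hβ : ∀ s n, β (s ⊗ₜ n) = m' s n := fun s n => rfl
  have hβ0 : ∀ z ∈ balancedRel ℤ (PathAlgebra k I) (asRight J) N', β z = 0 := by
    intro z hz
    refine Submodule.span_induction ?_ (map_zero _) ?_ ?_ hz
    · rintro _ ⟨s, a, n, rfl⟩
      rw [map_sub, hβ, hβ, sub_eq_zero]
      exact hm2 ⟨s, s.2⟩ a n
    · intro x y _ _ hx hy
      rw [map_add, hx, hy, add_zero]
    · intro c x _ hx
      rw [map_smul, hx, smul_zero]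
  have hβf : ∀ z, β ((f.toAddMonoidHom.toIntLinearMap.lTensor (asRight J)) z) = q z := by
    intro z
    induction z with
    | zero => rw [map_zero, map_zero, map_zero]
    | tmul s n => exact hm1 ⟨s, s.2⟩ n
    | add x y hx hy => rw [map_add, map_add, map_add, hx, hy]
  rw [injective_iff_map_eq_zero]
  intro x hx
  obtain ⟨z, rfl⟩ := Submodule.mkQ_surjective _ x
  have h1 := hβ0 _ ((Submodule.Quotient.mk_eq_zero _).1 hx)
  rw [hβf] at h1
  exact (Submodule.Quotient.mk_eq_zero _).2
    (balancedRel_le_int k ((Submodule.Quotient.mk_eq_zero _).1 h1))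

end Flat

/-! ### Smallness, and naturality of the complex in the second argument -/

section Resolution

variable {k : Type u} [Field k] {I : Type w} [Quiver.{t + 1} I] [Fintype I]
variable (J : Ideal (PathAlgebra k I)) [J.IsTwoSided]
variable (r : ℕ) (V : Type v) [AddCommGroup V] [Module (PathAlgebra k I ⧸ J) V]

section Small

variable [∀ i j : I, Finite (i ⟶ j)] [Small.{v} k]

instance : Small.{v} (GrTensor J r V) := by
  have : Small.{v} ↥(J ^ r) := small_subtype _ _
  have : Small.{v} (Gr J r) := small_of_surjective (Gr.mk_surjective J r)
  exact small_of_surjective (GrTensor.proj_surjective (J := J) (r := r) (V := V))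

instance {T : Type*} (h : T → I) (Y : T → Type*) [∀ s, AddCommGroup (Y s)] [∀ s, Module k (Y s)]
    [Small.{v} T] [∀ s, Small.{v} (Y s)] : Small.{v} (VCell J h Y) := by
  have : Small.{v} (BasisIndex (k := k) Y →₀ PathAlgebra k I ⧸ J) :=
    small_of_injective (DFunLike.coe_injective (F := BasisIndex (k := k) Y →₀ PathAlgebra k I ⧸ J))
  exact small_subtype _ _

end Small

variable {J r V}
variable {W : Type v} [AddCommGroup W] [Module (PathAlgebra k I ⧸ J) W] [Module k W]
  [IsScalarTower k (PathAlgebra k I ⧸ J) W]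
  {W' : Type v} [AddCommGroup W'] [Module (PathAlgebra k I ⧸ J) W'] [Module k W']
  [IsScalarTower k (PathAlgebra k I ⧸ J) W']

/-- Functoriality of the even cochains. -/
def EvenCochain.push (φ : W →ₗ[PathAlgebra k I ⧸ J] W') (f : EvenCochain J r V W) :
    EvenCochain J r V W' :=
  fun i => vmap J φ i ∘ₗ f i

/-- Functoriality of the odd cochains. -/
def OddCochain.push (φ : W →ₗ[PathAlgebra k I ⧸ J] W') (g : OddCochain J r V W) :
    OddCochain J r V W' :=
  fun i j α => vmap J φ j ∘ₗ g i j α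

/-- Naturality in W, together with that of the odd differential, is what allows the differentials to
be represented by maps of projective modules. -/
theorem dEven_push (φ : W →ₗ[PathAlgebra k I ⧸ J] W') (f : EvenCochain J r V W) :
    dEven J r V W' (f.push φ) = OddCochain.push φ (dEven J r V W f) := by
  funext i j α
  refine LinearMap.ext fun x => Subtype.ext ?_
  change φ (f j (arrMap J _ α x)) - Ideal.Quotient.mk J (arr k α) • φ (f i x) =
    φ (f j (arrMap J _ α x) - Ideal.Quotient.mk J (arr k α) • f i x)
  rw [map_sub, map_smul]

theorem OddCochain.deriv_push (φ : W →ₗ[PathAlgebra k I ⧸ J] W') (g : OddCochain J r V W)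
    (a : PathAlgebra k I) (x : GrTensor J r V) : (g.push φ).deriv a x = φ (g.deriv a x) := by
  have H : (g.push φ).deriv =
      (LinearMap.llcomp k _ _ _ (φ.restrictScalars k)).comp g.deriv := by
    refine lin_ext fun i j p => LinearMap.ext fun x => ?_
    change (g.push φ).deriv (ofPath k p) x = φ (g.deriv (ofPath k p) x)
    induction p with
    | nil =>
      rw [OddCochain.deriv, OddCochain.deriv, deriv_ofPath, deriv_ofPath]
      exact (map_zero φ).symm
    | cons p α ih =>
      rw [ofPath_cons, deriv_mul, deriv_mul, deriv_arr, deriv_arr, LinearMap.add_apply,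
        LinearMap.add_apply, LinearMap.comp_apply, LinearMap.comp_apply, ih, map_add]
      congr 1
      exact (map_smul φ _ _).symm
  exact congr($H a x)

/-- Both sides satisfy the formula that determines a connecting map. -/
theorem connecting_push (φ : W →ₗ[PathAlgebra k I ⧸ J] W') (g : OddCochain J r V W) :
    connecting (g.push φ) = φ ∘ₗ connecting g := by
  refine connecting_unique fun s x v => ?_
  rw [connecting_tmul, LinearMap.comp_apply, connecting_tmul, OddCochain.deriv_push]

theorem dOdd_eq_vmap (g : OddCochain J r V W) (i : I) :
    dOdd J r V W g i = vmap J (connecting g) i :=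
  LinearMap.ext fun x => Subtype.ext (dOdd_apply_coe J r V W g i x)

theorem dOdd_push (φ : W →ₗ[PathAlgebra k I ⧸ J] W') (g : OddCochain J r V W) :
    dOdd J r V W' (g.push φ) = EvenCochain.push φ (dOdd J r V W g) := by
  funext i
  rw [dOdd_eq_vmap, connecting_push, EvenCochain.push, dOdd_eq_vmap]
  rfl

/-- The idempotents e_i sum to 1. -/
theorem hom_eq_of_vmap_eq {X Y : Type*} [AddCommGroup X] [Module (PathAlgebra k I ⧸ J) X] [Module k X]
    [IsScalarTower k (PathAlgebra k I ⧸ J) X] [AddCommGroup Y] [Module (PathAlgebra k I ⧸ J) Y]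
    [Module k Y] [IsScalarTower k (PathAlgebra k I ⧸ J) Y] {φ ψ : X →ₗ[PathAlgebra k I ⧸ J] Y}
    (h : ∀ i, vmap J φ i = vmap J ψ i) : φ = ψ := by
  refine LinearMap.ext fun x => ?_
  rw [← sum_vtx_smul J x, map_sum, map_sum]
  exact Finset.sum_congr rfl fun i _ => congrArg Subtype.val (congr($(h i) (vproj J X i x)))

theorem connecting_eq_zero_of_dOdd {g : OddCochain J r V W} (hg : dOdd J r V W g = 0) :
    connecting g = 0 :=
  hom_eq_of_vmap_eq fun i => by
    rw [← dOdd_eq_vmap, hg]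
    rfl

variable [∀ i j : I, Finite (i ⟶ j)] [Small.{v} k]

variable (J r V) in
/-- The projective module `⨁ i, A e_i ⊗ (A^r ⊗_A V)_i`. -/
abbrev EvenProj : Type v := VProj.{u, w, t, v} J (fun i : I => i) fun i => vpart J (GrTensor J r V) i

variable (J r V) in
/-- The projective module `⨁ α, A e_{h(α)} ⊗ (A^r ⊗_A V)_{t(α)}`. -/
abbrev OddProj : Type v :=
  VProj.{u, w, t, v} J (fun α : Σ i j : I, (i ⟶ j) => α.2.1) fun α => vpart J (GrTensor J r V) α.1

end Resolution

/-! ### The degree-zero term A^0 ⊗_A V -/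

section GrZero

variable {R : Type u} [Ring R] (J : Ideal R) [J.IsTwoSided] (V : Type v) [AddCommGroup V]
  [Module (R ⧸ J) V]

/-- The map `V → A^0 ⊗_A V`, `v ↦ [1] ⊗ v`. -/
def GrTensor.ofVec : V →ₗ[R ⧸ J] GrTensor J 0 V where
  toFun v := GrTensor.tmul J 0 ⟨1, by rw [Submodule.pow_zero, Ideal.one_eq_top]; trivial⟩ v
  map_add' v v' := by
    rw [GrTensor.tmul, TensorProduct.tmul_add, map_add]
    rfl
  map_smul' a v := by
    obtain ⟨a, rfl⟩ := Ideal.Quotient.mk_surjective a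
    rw [GrTensor.tmul_smul, RingHom.id_apply, GrTensor.smul_tmul]
    congr 1
    exact Subtype.ext ((one_mul a).trans (mul_one a).symm)

/-- Well defined because J^1 = J acts on V by zero and the action is associative. It serves as a
left inverse of `GrTensor.ofVec`, so additivity is enough. -/
theorem GrTensor.exists_toVec : ∃ F : GrTensor J 0 V →+ V,
    ∀ (x : ↥(J ^ 0)) (v : V), F (GrTensor.tmul J 0 x v) = Ideal.Quotient.mk J (x : R) • v := by
  let T1 : ↥(J ^ 0) →ₗ[ℤ] (V →ₗ[ℤ] V) := LinearMap.mk₂ ℤ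
    (fun x v => Ideal.Quotient.mk J (x : R) • v)
    (fun x y v => by rw [Submodule.coe_add, map_add, add_smul])
    (fun c x v => by
      have : ((c • x : ↥(J ^ 0)) : R) = c • (x : R) := rfl
      rw [this, map_zsmul, smul_assoc])
    (fun x v v' => smul_add _ _ _)
    (fun c x v => smul_comm _ _ _)
  obtain ⟨F1, hF1⟩ := exists_factor (Gr.mk J 0).toAddMonoidHom.toIntLinearMap
    (Gr.mk_surjective J 0) T1 fun x hx => LinearMap.ext fun v => by
      have hx' : (x : R) ∈ J ^ (0 + 1) :=
        (Submodule.Quotient.mk_eq_zero ((J ^ (0 + 1)).submoduleOf (J ^ 0))).1 hx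
      rw [zero_add, Submodule.pow_one] at hx'
      change Ideal.Quotient.mk J (x : R) • v = 0
      rw [Ideal.Quotient.eq_zero_iff_mem.2 hx', zero_smul]
  let T : Gr J 0 ⊗[ℤ] V →ₗ[ℤ] V := TensorProduct.lift F1
  have hT : ∀ (x : ↥(J ^ 0)) (v : V), T (Gr.mk J 0 x ⊗ₜ v) = Ideal.Quotient.mk J (x : R) • v :=
    fun x v => congr($(hF1 x) v)
  have hTs : ∀ (a : R) z, T (Ideal.Quotient.mk J a • z) = Ideal.Quotient.mk J a • T z := by
    intro a z
    induction z with
    | zero => rw [smul_zero, map_zero, smul_zero]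
    | tmul y v =>
      obtain ⟨x, rfl⟩ := Gr.mk_surjective J 0 y
      refine (hT (a • x) v).trans ?_
      rw [hT, ← mul_smul, ← map_mul]
      rfl
    | add x y hx hy => rw [smul_add, map_add, map_add, hx, hy, smul_add]
  have hT0 : ∀ z ∈ balancedRel (R ⧸ J) (R ⧸ J) (Gr J 0) V, T z = 0 := by
    intro z hz
    refine Submodule.span_induction ?_ (map_zero _) ?_ ?_ hz
    · rintro _ ⟨y, a, v, rfl⟩
      obtain ⟨x, rfl⟩ := Gr.mk_surjective J 0 y
      obtain ⟨a, rfl⟩ := Ideal.Quotient.mk_surjective a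
      rw [map_sub, Gr.op_mk_smul, hT, hT, sub_eq_zero, ← mul_smul, ← map_mul]
      rfl
    · intro x y _ _ hx hy
      rw [map_add, hx, hy, add_zero]
    · intro a x _ hx
      obtain ⟨a, rfl⟩ := Ideal.Quotient.mk_surjective a
      rw [hTs, hx, smul_zero]
  let π : Gr J 0 ⊗[ℤ] V →ₗ[ℤ] GrTensor J 0 V :=
    (GrTensor.proj J 0 V).toAddMonoidHom.toIntLinearMap
  have hπ : Function.Surjective π :=
    Submodule.mkQ_surjective (balancedRel (R ⧸ J) (R ⧸ J) (Gr J 0) V)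
  have hπ0 : ∀ z, π z = 0 → T z = 0 := fun z hz => hT0 z
    ((Submodule.Quotient.mk_eq_zero (balancedRel (R ⧸ J) (R ⧸ J) (Gr J 0) V)).1 hz)
  obtain ⟨F, hF⟩ := exists_factor π hπ T hπ0
  exact ⟨F.toAddMonoidHom, fun x v => (hF (Gr.mk J 0 x ⊗ₜ v)).trans (hT x v)⟩

theorem GrTensor.ofVec_bijective : Function.Bijective (GrTensor.ofVec J V) := by
  constructor
  · obtain ⟨F, hF⟩ := GrTensor.exists_toVec J V
    refine Function.LeftInverse.injective (g := F) fun v => (hF _ v).trans ?_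
    rw [map_one, one_smul]
  · intro z
    refine GrTensor.induction J 0 (p := fun z => ∃ v, GrTensor.ofVec J V v = z)
      ⟨0, map_zero _⟩ ?_ ?_ z
    · rintro _ _ ⟨v, rfl⟩ ⟨v', rfl⟩
      exact ⟨v + v', map_add _ _ _⟩
    · intro x v
      refine ⟨Ideal.Quotient.mk J (x : R) • v, ?_⟩
      refine (GrTensor.tmul_smul J 0 _ _ v).trans ?_
      congr 1
      exact Subtype.ext (one_mul _)

/-- The isomorphism `A^0 ⊗_A V ≃ V`. -/
def GrTensor.zeroEquiv : GrTensor J 0 V ≃ₗ[R ⧸ J] V :=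
  (LinearEquiv.ofBijective (GrTensor.ofVec J V) (GrTensor.ofVec_bijective J V)).symm

end GrZero

/-! ### The projective resolution and its exactness -/

section Resolution

variable {k : Type u} [Field k] {I : Type w} [Quiver.{t + 1} I] [Fintype I]
variable (J : Ideal (PathAlgebra k I)) [J.IsTwoSided]
variable (r : ℕ) (V : Type v) [AddCommGroup V] [Module (PathAlgebra k I ⧸ J) V]
variable (W : Type v) [AddCommGroup W] [Module (PathAlgebra k I ⧸ J) W] [Module k W]
  [IsScalarTower k (PathAlgebra k I ⧸ J) W]
variable [∀ i j : I, Finite (i ⟶ j)] [Small.{v} k]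

/-- The universal even cochain. -/
def evenUniv : EvenCochain J r V (EvenProj J r V) := fun i =>
  VProj.univ J (fun i : I => i) (fun i => vpart J (GrTensor J r V) i) i

/-- The universal odd cochain. -/
def oddUniv : OddCochain J r V (OddProj J r V) := fun i j α =>
  VProj.univ J (fun α : Σ i j : I, (i ⟶ j) => α.2.1) (fun α => vpart J (GrTensor J r V) α.1)
    ⟨i, j, α⟩

/-- Even cochains with values in `W` are the maps to `W` from a projective module. -/
def evenEquiv : (EvenProj J r V →ₗ[PathAlgebra k I ⧸ J] W) ≃ₗ[k] EvenCochain J r V W :=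
  LinearEquiv.ofBijective
    { toFun := fun φ => (evenUniv J r V).push φ
      map_add' := fun _ _ => rfl
      map_smul' := fun _ _ => rfl }
    ⟨fun _ _ h => VProj.hom_ext J fun i => congrFun h i, fun f =>
      (VProj.exists_hom J (fun i : I => i) _ f).imp fun _ h => funext h⟩

/-- Odd cochains with values in `W` are the maps to `W` from a projective module. -/
def oddEquiv : (OddProj J r V →ₗ[PathAlgebra k I ⧸ J] W) ≃ₗ[k] OddCochain J r V W :=
  LinearEquiv.ofBijective
    { toFun := fun φ => (oddUniv J r V).push φ
      map_add' := fun _ _ => rfl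
      map_smul' := fun _ _ => rfl }
    ⟨fun _ _ h => VProj.hom_ext J fun α => congrFun (congrFun (congrFun h α.1) α.2.1) α.2.2,
      fun f => (VProj.exists_hom J (fun α : Σ i j : I, (i ⟶ j) => α.2.1) _
        fun α => f α.1 α.2.1 α.2.2).imp fun _ h =>
          funext fun i => funext fun j => funext fun α => h ⟨i, j, α⟩⟩

/-- The differential from the odd to the even projective module, which represents `dEven`. -/
def oddToEven : OddProj J r V →ₗ[PathAlgebra k I ⧸ J] EvenProj J r V :=
  (oddEquiv J r V _).symm (dEven J r V _ (evenUniv J r V))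

/-- The differential from the even to the odd projective module, which represents `dOdd`. -/
def evenToOdd : EvenProj J (r + 1) V →ₗ[PathAlgebra k I ⧸ J] OddProj J r V :=
  (evenEquiv J (r + 1) V _).symm (dOdd J r V _ (oddUniv J r V))

variable {W}

theorem push_oddToEven : (oddUniv J r V).push (oddToEven J r V) =
    dEven J r V _ (evenUniv J r V) :=
  (oddEquiv J r V _).apply_symm_apply _

theorem push_evenToOdd : (evenUniv J (r + 1) V).push (evenToOdd J r V) =
    dOdd J r V _ (oddUniv J r V) :=
  (evenEquiv J (r + 1) V _).apply_symm_apply _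

/-- Yoneda: every even cochain is the universal one pushed along some φ, and the differential
commutes with pushing. -/
theorem oddEquiv_comp (φ : EvenProj J r V →ₗ[PathAlgebra k I ⧸ J] W) :
    oddEquiv J r V W (φ ∘ₗ oddToEven J r V) = dEven J r V W (evenEquiv J r V W φ) := by
  refine Eq.trans ?_ (dEven_push φ (evenUniv J r V)).symm
  rw [← push_oddToEven]
  rfl

theorem evenEquiv_comp (φ : OddProj J r V →ₗ[PathAlgebra k I ⧸ J] W) :
    evenEquiv J (r + 1) V W (φ ∘ₗ evenToOdd J r V) = dOdd J r V W (oddEquiv J r V W φ) := by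
  refine Eq.trans ?_ (dOdd_push φ (oddUniv J r V)).symm
  rw [← push_evenToOdd]
  rfl

/-- The cochain of q is a cocycle, hence a coboundary after some injection φ : W → E. Then φ ∘ q
factors through `oddToEven`, so φ (q y) = 0. -/
theorem apply_eq_zero_of_comp_evenToOdd (q : OddProj J r V →ₗ[PathAlgebra k I ⧸ J] W)
    (hq : q ∘ₗ evenToOdd J r V = 0) {y : OddProj J r V} (hy : oddToEven J r V y = 0) :
    q y = 0 := by
  have hd := evenEquiv_comp J r V q
  rw [hq, map_zero] at hd
  obtain ⟨E, _, _, _, _, φ, f, hφ, hf⟩ :=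
    exists_dEven_eq (oddEquiv J r V W q) (connecting_eq_zero_of_dOdd hd.symm)
  obtain ⟨ψ, rfl⟩ := (evenEquiv J r V E).surjective f
  rw [← oddEquiv_comp] at hf
  have H : ψ ∘ₗ oddToEven J r V = φ ∘ₗ q := (oddEquiv J r V E).injective hf
  have h1 : φ (q y) = 0 := by
    rw [← LinearMap.comp_apply, ← H, LinearMap.comp_apply, hy, map_zero]
  exact hφ (h1.trans (map_zero φ).symm)

/-- The even cochain of q is a cocycle, which means that its components commute with the arrows. -/
theorem exists_hom_of_comp_oddToEven (q : EvenProj J r V →ₗ[PathAlgebra k I ⧸ J] W)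
    (hq : q ∘ₗ oddToEven J r V = 0) :
    ∃ F : GrTensor J r V →ₗ[PathAlgebra k I ⧸ J] W, ∀ i, vmap J F i = evenEquiv J r V W q i := by
  have hd := oddEquiv_comp J r V q
  rw [hq, map_zero] at hd
  exact exists_hom_of_comm (evenEquiv J r V W q) fun i j α =>
    (sub_eq_zero.1 (congrFun (congrFun (congrFun hd.symm i) j) α))

/-- The kernel is detected by the projection q onto the cokernel of `evenToOdd`; the opposite
inclusion is d² = 0 on the universal even cochain. -/
theorem exact_evenToOdd_oddToEven :
    Function.Exact (evenToOdd J r V) (oddToEven J r V) := by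
  intro y
  constructor
  · intro hy
    let q : OddProj J r V →ₗ[PathAlgebra k I ⧸ J]
      OddProj J r V ⧸ LinearMap.range (evenToOdd J r V) := Submodule.mkQ _
    exact (Submodule.Quotient.mk_eq_zero _).1 (apply_eq_zero_of_comp_evenToOdd J r V q
      (LinearMap.range_mkQ_comp _) hy)
  · rintro ⟨x, rfl⟩
    have H : oddToEven J r V ∘ₗ evenToOdd J r V = 0 := by
      refine (evenEquiv J (r + 1) V _).injective ?_
      rw [evenEquiv_comp, map_zero]
      have h1 : oddEquiv J r V _ (oddToEven J r V) = dEven J r V _ (evenUniv J r V) :=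
        push_oddToEven J r V
      rw [h1]
      exact congr($(dOdd_comp_dEven J r V (EvenProj J r V)) (evenUniv J r V))
    exact congr($H x)

/-- The map ε represents the identity cochain. The projection onto the cokernel of `oddToEven` is a
cocycle, so it factors through ε, and this bounds the kernel of ε. -/
theorem exists_augmentation : ∃ ε : EvenProj J r V →ₗ[PathAlgebra k I ⧸ J] GrTensor J r V,
    (∀ i, vmap J ε i ∘ₗ evenUniv J r V i = LinearMap.id) ∧ Function.Surjective ε ∧
      Function.Exact (oddToEven J r V) ε := by
  obtain ⟨ε, hε⟩ := VProj.exists_hom J (fun i : I => i)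
    (fun i => vpart J (GrTensor J r V) i) (W := GrTensor J r V) fun i => LinearMap.id
  have hε' : ∀ i (x : vpart J (GrTensor J r V) i), ε (evenUniv J r V i x) = x :=
    fun i x => congrArg Subtype.val congr($(hε i) x)
  refine ⟨ε, hε, fun x => ?_, fun y => ⟨fun hy => ?_, ?_⟩⟩
  · refine ⟨∑ i : I, evenUniv J r V i (vproj J _ i x), ?_⟩
    rw [map_sum, Finset.sum_congr rfl fun i _ => hε' i _]
    exact sum_vtx_smul J x
  · let q : EvenProj J r V →ₗ[PathAlgebra k I ⧸ J]
      EvenProj J r V ⧸ LinearMap.range (oddToEven J r V) := Submodule.mkQ _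
    obtain ⟨F, hF⟩ := exists_hom_of_comp_oddToEven J r V q (LinearMap.range_mkQ_comp _)
    have H : F ∘ₗ ε = q := by
      refine VProj.hom_ext J fun i => ?_
      refine Eq.trans ?_ (hF i)
      refine Eq.trans ?_ (LinearMap.comp_id (vmap J F i))
      rw [← hε i]
      rfl
    have h2 : q y = 0 := by rw [← H, LinearMap.comp_apply, hy, map_zero]
    exact (Submodule.Quotient.mk_eq_zero _).1 h2
  · rintro ⟨x, rfl⟩
    have H : ε ∘ₗ oddToEven J r V = 0 := by
      refine VProj.hom_ext J fun α => ?_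
      obtain ⟨i, j, α⟩ := α
      have h1 := congrFun (congrFun (congrFun (push_oddToEven J r V) i) j) α
      refine LinearMap.ext fun x => Subtype.ext ?_
      have h2 := congrArg Subtype.val (congr($h1 x))
      change ε (oddToEven J r V (oddUniv J r V i j α x)) = 0
      refine (congrArg ε h2).trans ?_
      change ε (evenUniv J r V j (arrMap J _ α x) -
        Ideal.Quotient.mk J (arr k α) • (evenUniv J r V i x : EvenProj J r V)) = 0
      rw [map_sub, map_smul, hε', hε', sub_eq_zero]
      rfl
    exact congr($H x)

/-- Every connecting map factors through the universal one, so a single injective example suffices.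
-/
theorem connecting_oddUniv_injective : Function.Injective (connecting (oddUniv J r V)) := by
  obtain ⟨E, _, _, _, _, g, hg⟩ := exists_connecting_injective.{u, w, t, v} J r V
  obtain ⟨ψ, rfl⟩ := (oddEquiv J r V E).surjective g
  have h : connecting (oddEquiv J r V E ψ) = ψ ∘ₗ connecting (oddUniv J r V) :=
    connecting_push ψ (oddUniv J r V)
  rw [h] at hg
  exact Function.Injective.of_comp (f := ψ) hg

/-- Since `evenToOdd` is ε followed by an injective connecting map, its kernel is that of ε, the
image of the next `oddToEven`. -/
theorem exact_oddToEven_evenToOdd :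
    Function.Exact (oddToEven J (r + 1) V) (evenToOdd J r V) := by
  obtain ⟨ε, hε, -, hex⟩ := exists_augmentation J (r + 1) V
  -- Both maps represent the same even cochain, the vertex components of the connecting map, as ε
  -- represents the identity.
  have H : evenToOdd J r V = connecting (oddUniv J r V) ∘ₗ ε := by
    refine VProj.hom_ext J fun i => ?_
    refine (congrFun (push_evenToOdd J r V) i).trans ?_
    rw [dOdd_eq_vmap]
    refine Eq.trans (LinearMap.comp_id (vmap J (connecting (oddUniv J r V)) i)).symm ?_
    rw [← hε i]
    rfl
  intro y
  rw [← hex y, H, LinearMap.comp_apply]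
  exact map_eq_zero_iff _ (connecting_oddUniv_injective J r V)

/-- The modules of the projective resolution, indexed like `cochainObj`. -/
def resObj : ℕ → ℕ → ModuleCat.{v} (PathAlgebra k I ⧸ J)
  | r, 0 => ModuleCat.of _ (EvenProj J r V)
  | r, 1 => ModuleCat.of _ (OddProj J r V)
  | r, n + 2 => resObj (r + 1) n

theorem resObj_projective : ∀ r n : ℕ, Module.Projective (PathAlgebra k I ⧸ J) (resObj J V r n)
  | _, 0 => VProj.projective J _ _
  | _, 1 => VProj.projective J _ _
  | r, n + 2 => resObj_projective (r + 1) n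

/-- The differentials of the projective resolution. -/
def resD : ∀ r n : ℕ, resObj J V r (n + 1) →ₗ[PathAlgebra k I ⧸ J] resObj J V r n
  | r, 0 => oddToEven J r V
  | r, 1 => evenToOdd J r V
  | r, n + 2 => resD (r + 1) n

theorem resD_exact : ∀ r n : ℕ, Function.Exact (resD J V r (n + 1)) (resD J V r n)
  | r, 0 => exact_evenToOdd_oddToEven J r V
  | r, 1 => exact_oddToEven_evenToOdd J r V
  | r, n + 2 => resD_exact (r + 1) n

variable (W) in
/-- The identification of `C^•(V, W)` with `Hom_A(P, W)`. -/
def resEquiv : ∀ r n : ℕ,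
    (resObj J V r n →ₗ[PathAlgebra k I ⧸ J] W) ≃ₗ[k] cochainObj J V W r n
  | r, 0 => evenEquiv J r V W
  | r, 1 => oddEquiv J r V W
  | r, n + 2 => resEquiv (r + 1) n

theorem cochainD_resEquiv : ∀ (r n : ℕ) (φ : resObj J V r n →ₗ[PathAlgebra k I ⧸ J] W),
    (cochainD J V W r n).hom (resEquiv J V W r n φ) =
      resEquiv J V W r (n + 1) (φ ∘ₗ resD J V r n)
  | r, 0, φ => (oddEquiv_comp J r V φ).symm
  | r, 1, φ => (evenEquiv_comp J r V φ).symm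
  | r, n + 2, φ => cochainD_resEquiv (r + 1) n φ

variable (W) in
-- The resolution at r = 0 ends in A^0 ⊗_A V, so its augmentation is composed with the isomorphism
-- to V.
theorem nonempty_ext_equiv (p : ℕ) :
    Nonempty (CategoryTheory.Abelian.Ext (ModuleCat.of (PathAlgebra k I ⧸ J) V)
      (ModuleCat.of (PathAlgebra k I ⧸ J) W) p ≃ₗ[k] (cochainComplex J V W).homology p) := by
  obtain ⟨ε, -, hε, hex⟩ := exists_augmentation J 0 V
  refine ext_equiv_homology (ModuleCat.of (PathAlgebra k I ⧸ J) V) W (resObj J V 0)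
    (resObj_projective J V 0) (resD J V 0) ((GrTensor.zeroEquiv J V).toLinearMap ∘ₗ ε)
    ((GrTensor.zeroEquiv J V).surjective.comp hε) (fun y => ?_) (resD_exact J V 0)
    (cochainComplex J V W) (resEquiv J V W 0) (fun n φ => ?_) p
  · refine Iff.trans ?_ (hex y)
    exact (GrTensor.zeroEquiv J V).map_eq_zero_iff
  · refine Eq.trans ?_ (cochainD_resEquiv J V 0 n φ)
    refine congrArg (fun f : cochainObj J V W 0 n ⟶ cochainObj J V W 0 (n + 1) =>
      f.hom (resEquiv J V W 0 n φ)) ?_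
    exact CochainComplex.of_d (cochainObj J V W 0) (cochainD J V W 0) n

end Resolution

end QuiverExt

end

theorem mainTheorem7 {k : Type u} [Field k]
    {I : Type w} [Fintype I] [Quiver.{t + 1} I] [∀ i j : I, Finite (i ⟶ j)]
    (J : Ideal (QuiverExt.PathAlgebra k I)) [J.IsTwoSided] :
    -- (K1)
    (∀ p : ℕ, Module.Free k (QuiverExt.Gr J p)) ∧
    -- (K2)
    QuiverExt.RightFlat (QuiverExt.PathAlgebra k I) (QuiverExt.asRight J) ∧
    -- the `Ext` groups over `A = kQ / J`
    ∀ [Small.{v} k]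
      (V : Type v) [AddCommGroup V] [Module (QuiverExt.PathAlgebra k I ⧸ J) V]
      (W : Type v) [AddCommGroup W] [Module (QuiverExt.PathAlgebra k I ⧸ J) W]
      [Module k W] [IsScalarTower k (QuiverExt.PathAlgebra k I ⧸ J) W] (p : ℕ),
      Nonempty
        (CategoryTheory.Abelian.Ext (ModuleCat.of (QuiverExt.PathAlgebra k I ⧸ J) V)
            (ModuleCat.of (QuiverExt.PathAlgebra k I ⧸ J) W) p
          ≃ₗ[k] (QuiverExt.cochainComplex J V W).homology p) :=
  ⟨fun _ => Module.Free.of_divisionRing k _, QuiverExt.rightFlat_asRight J,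
    fun V _ _ W _ _ _ _ p => QuiverExt.nonempty_ext_equiv J V W p⟩
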